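/- Let $I$ be a finite alphabet with at least two letters and let $A=(a_{ij})_{i,j\in I}$ be an irreducible matrix with entries in $\{0,1\}$ such that every row and every column has at least one entry equal to $1$. Let $\mathcal O_A$ be the Cuntz--Krieger algebra, that is, the universal unital $C^*$-algebra generated by partial isometries $S_i$ ($i\in I$) with $\sum_{j}S_jS_j^*=1$ and $S_i^*S_i=\sum_j a_{ij}S_jS_j^*$ for all $i$. Let $\Sigma_A=\{(w_0w_1\dots)\in I^{\mathbb N_0} : a_{w_nw_{n+1}}=1 \text{ for all } n\}$ with the product topology and the left shift $\theta$. Regard $C(\Sigma_A)$ (continuous complex-valued functions) as a subalgebra of $\mathcal O_A$ through the $*$-homomorphism with $\mathbf 1_{[w]}\mapsto S_wS_w^*$, where $S_w=S_{w_0}\cdots S_{w_{n-1}}$ and $[w]$ is the cylinder set of the finite word $w=w_0\dots w_{n-1}$. Let $H:\Sigma_A\to\mathbb R$ be continuous and let $\beta\in\mathbb R\setminus\{0\}$. For $t\in\mathbb R$ let $\alpha_H^t$ be the $*$-automorphism of $\mathcal O_A$ with $\alpha_H^t(S_j)=e^{itH}S_j$ for all $j\in I$. An $(H,\beta)$-KMS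 state is a state $\sigma$ on $\mathcal O_A$ (a linear functional with $\|\sigma\|=1$ and $\sigma(X^*X)\ge 0$ for all $X$) for which there is a norm-dense subset $D\subseteq\mathcal O_A$ such that for all $X,Y\in D$ there is a function $F$ that is bounded and continuous on the closed strip between the lines $\operatorname{Im}z=0$ and $\operatorname{Im}z=\beta$, is analytic in the interior of that strip, and satisfies $F(t)=\sigma(X\alpha_H^t(Y))$ and $F(t+i\beta)=\sigma(\alpha_H^t(Y)X)$ for all $t\in\mathbb R$. Let $\mathcal L_{-\beta H}:C(\Sigma_A)\to C(\Sigma_A)$, $(\mathcal L_{-\beta H}f)(x)=\sum_{y\in\theta^{-1}\{x\}}e^{-\beta H(y)}f(y)$, be the Perron--Frobenius operator, and let $\operatorname{Fix}(\mathcal L_{-\beta H}^*)$ be the set of the Borel probability measures $\mu$ on $\Sigma_A$ with $\mathcal L_{-\beta H}^*\mu=\mu$, that is, with $\int \mathcal L_{-\beta H}f\,d\mu=\int f\,d\mu$ for all $f\in C(\Sigma_A)$. Then for every $(H,\beta)$-KMS state $\sigma$ there is exactly one Borel probability measure $m_\sigma$ on $\Sigma_A$ with $\sigma(f)=\int f\,dm_\sigma$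 for all $f\in C(\Sigma_A)$, and the assignment $\Theta(\sigma)=m_\sigma$ is a surjective map from the set of all $(H,\beta)$-KMS states onto $\operatorname{Fix}(\mathcal L_{-\beta H}^*)$. If, furthermore, $H\ge 0$, then the restriction of $\Theta$ to $\mathcal S_0=\{\sigma : \sigma \text{ is an } (H,\beta)\text{-KMS state with } m_\sigma(\{H=0\})=0\}$ is a bijection onto its image, and this image is $\{\mu\in\operatorname{Fix}(\mathcal L_{-\beta H}^*) : \mu(\{H=0\})=0\}$. -/

import Mathlib

open MeasureTheory Set Filter Topology
open scoped ENNReal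

set_option linter.unusedSectionVars false

universe u

/-- A transition matrix over the finite alphabet `I`: a matrix with entries in `{0, 1}` such that
each row and each column contains at least one entry equal to one. -/
structure TransitionMatrix (I : Type u) where
  /-- the entries of the matrix -/
  mat : Matrix I I ℤ
  zero_or_one : ∀ i j, mat i j = 0 ∨ mat i j = 1
  row : ∀ i, ∃ j, mat i j = 1
  col : ∀ j, ∃ i, mat i j = 1

namespace TransitionMatrix

variable {I : Type u} (A : TransitionMatrix I)

/-! ### The subshift of finite type -/

/-- The space `Σ_A` of the infinite words `w₀ w₁ w₂ …` with `a_{w_n w_{n+1}} = 1` for all `n`. -/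
def Shift : Type u := {x : ℕ → I // ∀ n, A.mat (x n) (x (n + 1)) = 1}

namespace Shift

variable {A}

/-- `Σ_A` carries the topology induced by the product topology of `I^ℕ`. -/
instance [TopologicalSpace I] : TopologicalSpace A.Shift := instTopologicalSpaceSubtype

/-- `Σ_A` carries its Borel σ-algebra. -/
instance [TopologicalSpace I] : MeasurableSpace A.Shift := borel _

instance [TopologicalSpace I] : BorelSpace A.Shift := ⟨rfl⟩

/-- The `n`-th letter of an infinite word. -/
def letter (x : A.Shift) (n : ℕ) : I := x.1 n

theorem letter_rel (x : A.Shift) (n : ℕ) : A.mat (x.letter n) (x.letter (n + 1)) = 1 := x.2 n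

theorem ext {x y : A.Shift} (h : ∀ n, x.letter n = y.letter n) : x = y :=
  Subtype.ext (funext h)

theorem continuous_letter [TopologicalSpace I] (n : ℕ) :
    Continuous fun x : A.Shift => x.letter n :=
  (continuous_apply n).comp continuous_subtype_val

/-- The left shift `θ (w₀ w₁ w₂ …) = (w₁ w₂ …)`. -/
def shift (x : A.Shift) : A.Shift := ⟨fun n => x.1 (n + 1), fun n => x.2 (n + 1)⟩

/-- The infinite word `j w₀ w₁ …`, if it is admissible. -/
def cons (j : I) (x : A.Shift) (h : A.mat j (x.letter 0) = 1) : A.Shift :=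
  ⟨fun n => Nat.casesOn n j x.1, fun n => by cases n with
    | zero => exact h
    | succ n => exact x.2 n⟩

theorem shift_eq_iff (x y : A.Shift) :
    y.shift = x ↔ ∃ (j : I) (h : A.mat j (x.letter 0) = 1), y = cons j x h := by
  constructor
  · rintro rfl
    refine ⟨y.1 0, y.2 0, ?_⟩
    apply Subtype.ext
    funext n
    cases n <;> rfl
  · rintro ⟨j, h, rfl⟩
    rfl

section Topology

variable [Fintype I] [TopologicalSpace I] [DiscreteTopology I]

instance : CompactSpace A.Shift := by
  have hcl : IsClosed {x : ℕ → I | ∀ n, A.mat (x n) (x (n + 1)) = 1} := by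
    rw [ofPred_forall]
    refine isClosed_iInter fun n => ?_
    have : Continuous fun x : ℕ → I => (x n, x (n + 1)) := by fun_prop
    exact (isClosed_discrete {p : I × I | A.mat p.1 p.2 = 1}).preimage this
  exact isCompact_iff_compactSpace.mp hcl.isCompact

instance : T2Space A.Shift := inferInstanceAs (T2Space {_x : ℕ → I // _})

end Topology

/-- The cylinder set `[w]` of the infinite words that begin with the finite word `w`. -/
def cylinder (w : List I) : Set A.Shift := {x | ∀ n : Fin w.length, x.letter n = w.get n}

theorem isClopen_cylinder [TopologicalSpace I] [DiscreteTopology I] (w : List I) :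
    IsClopen (cylinder w : Set A.Shift) := by
  have : (cylinder w : Set A.Shift) =
      ⋂ n : Fin w.length, (fun x : A.Shift => x.letter n) ⁻¹' {w.get n} := by
    ext x; simp [cylinder]
  rw [this]
  exact isClopen_iInter_of_finite fun n => (isClopen_discrete _).preimage (continuous_letter _)

/-- The indicator function of the cylinder set `[w]`, as a continuous function. -/
noncomputable def cylInd [TopologicalSpace I] [DiscreteTopology I] (w : List I) :
    C(A.Shift, ℂ) where
  toFun := (cylinder w).indicator 1
  continuous_toFun := IsClopen.continuous_indicator (isClopen_cylinder w) continuous_one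

theorem cylInd_apply [TopologicalSpace I] [DiscreteTopology I] (w : List I) (x : A.Shift) :
    cylInd w x = (cylinder w).indicator 1 x := rfl

/-! ### The Perron-Frobenius operator -/

section Transfer

theorem cons_inj {j k : I} {x : A.Shift} {h : A.mat j (x.letter 0) = 1}
    {h' : A.mat k (x.letter 0) = 1} (e : cons j x h = cons k x h') : j = k :=
  congrArg (fun y : A.Shift => y.letter 0) e

variable [Fintype I]

theorem finite_preimage (x : A.Shift) : (shift ⁻¹' {x} : Set A.Shift).Finite := by
  classical
  refine (finite_range fun j : I =>
    if h : A.mat j (x.letter 0) = 1 then cons j x h else x).subset ?_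
  intro y hy
  obtain ⟨j, h, rfl⟩ := (shift_eq_iff x y).1 hy
  exact ⟨j, by simp [h]⟩

open Classical in
theorem finsum_preimage (F : A.Shift → ℂ) (x : A.Shift) :
    ∑ᶠ y ∈ (shift ⁻¹' {x} : Set A.Shift), F y =
      ∑ j : I, if h : A.mat j (x.letter 0) = 1 then F (cons j x h) else 0 := by
  rw [finsum_mem_eq_finite_toFinset_sum _ (finite_preimage x)]
  symm
  have e1 : (∑ j : I, if h : A.mat j (x.letter 0) = 1 then F (cons j x h) else 0) =
      ∑ j ∈ Finset.univ.filter (fun j : I => A.mat j (x.letter 0) = 1),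
        if h : A.mat j (x.letter 0) = 1 then F (cons j x h) else 0 := by
    rw [Finset.sum_filter]
    refine Finset.sum_congr rfl fun j _ => ?_
    split_ifs <;> rfl
  rw [e1]
  refine Finset.sum_bij (fun j hj => cons j x (Finset.mem_filter.1 hj).2) ?_ ?_ ?_ ?_
  · intro j hj
    rw [Finite.mem_toFinset]
    exact (shift_eq_iff _ _).2 ⟨j, _, rfl⟩
  · intro j _ k _ e
    exact cons_inj e
  · intro y hy
    rw [Finite.mem_toFinset] at hy
    obtain ⟨j, h, rfl⟩ := (shift_eq_iff x y).1 hy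
    exact ⟨j, by simp [h], rfl⟩
  · intro j hj
    rw [dif_pos (Finset.mem_filter.1 hj).2]

variable [TopologicalSpace I] [DiscreteTopology I]

open Classical in
theorem continuous_branch (F : C(A.Shift, ℂ)) (j : I) :
    Continuous fun x : A.Shift =>
      if h : A.mat j (x.letter 0) = 1 then F (cons j x h) else 0 := by
  rw [continuous_iff_continuousAt]
  intro x
  have hU : IsOpen {y : A.Shift | y.letter 0 = x.letter 0} :=
    (isOpen_discrete {x.letter 0}).preimage (continuous_letter 0)
  by_cases hx : A.mat j (x.letter 0) = 1
  · have hc : ContinuousOn (fun x : A.Shift =>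
      if h : A.mat j (x.letter 0) = 1 then F (cons j x h) else 0)
        {y : A.Shift | y.letter 0 = x.letter 0} := by
      rw [continuousOn_iff_continuous_domRestrict]
      have hy : ∀ y : {y : A.Shift | y.letter 0 = x.letter 0}, A.mat j (y.1.letter 0) = 1 := by
        intro y
        have h' : y.1.letter 0 = x.letter 0 := y.2
        rw [h', hx]
      have : Continuous fun y : {y : A.Shift | y.letter 0 = x.letter 0} =>
          F (cons j y.1 (hy y)) := by
        refine F.continuous.comp (continuous_induced_rng.2 (continuous_pi fun n => ?_))
        cases n with
        | zero => exact continuous_const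
        | succ n => exact (continuous_letter n).comp continuous_subtype_val
      refine this.congr fun y => ?_
      simp [hy y]
    exact hc.continuousAt (hU.mem_nhds rfl)
  · refine (continuousAt_const (y := (0 : ℂ))).congr ?_
    filter_upwards [hU.mem_nhds rfl] with y hy
    have hy' : y.letter 0 = x.letter 0 := hy
    rw [dif_neg]
    rwa [hy']

/-- The Perron-Frobenius operator `L_H : C(Σ_A) → C(Σ_A)` of a real potential `H`,
`(L_H f)(x) = ∑_{y ∈ θ⁻¹ {x}} e^{H(y)} f(y)`. -/
noncomputable def perronFrobenius (H : C(A.Shift, ℝ)) (f : C(A.Shift, ℂ)) : C(A.Shift, ℂ) where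
  toFun x := ∑ᶠ y ∈ (shift ⁻¹' {x} : Set A.Shift), (Real.exp (H y) : ℂ) * f y
  continuous_toFun := by
    classical
    let F : C(A.Shift, ℂ) := ⟨fun y => (Real.exp (H y) : ℂ) * f y, by fun_prop⟩
    have := continuous_finsetSum Finset.univ fun j (_ : j ∈ Finset.univ) => continuous_branch F j
    refine this.congr fun x => ?_
    exact (finsum_preimage F x).symm

/-- The set of the Borel probability measures `μ` on `Σ_A` with `L_H^* μ = μ`, that is of the
probability eigenmeasures of the dual Perron-Frobenius operator for the eigenvalue `1`. -/
def eigenmeasures (H : C(A.Shift, ℝ)) : Set (ProbabilityMeasure A.Shift) :=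
  {μ | ∀ f : C(A.Shift, ℂ),
    ∫ x, perronFrobenius H f x ∂(μ : Measure A.Shift) = ∫ x, f x ∂(μ : Measure A.Shift)}

end Transfer

end Shift

/-! ### Cuntz-Krieger families and the Cuntz-Krieger algebra -/

section Families

variable [Fintype I]

open scoped CStarAlgebra

/-- A family of partial isometries `(S_i)_{i ∈ I}` in a unital `*`-ring that satisfies the
Cuntz-Krieger relations `∑_j S_j S_j^* = 1` and `S_i^* S_i = ∑_j a_{ij} S_j S_j^*`. -/
structure IsCKFamily {B : Type*} [Ring B] [StarRing B] (S : I → B) : Prop where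
  partial_isometry : ∀ i, S i * star (S i) * S i = S i
  sum_eq_one : ∑ j, S j * star (S j) = 1
  star_mul_self : ∀ i, star (S i) * S i = ∑ j, A.mat i j • (S j * star (S j))

/-- A Cuntz-Krieger family in some nonzero unital C⋆-algebra. -/
structure CKRep : Type (u + 1) where
  /-- the target C⋆-algebra -/
  B : Type u
  [cstar : CStarAlgebra B]
  [nontriv : Nontrivial B]
  /-- the family -/
  S : I → B
  isCK : A.IsCKFamily S

attribute [instance] CKRep.cstar CKRep.nontriv

/-- The `ℓ^∞`-product of the target algebras of all Cuntz-Krieger families. -/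
abbrev CKProduct : Type (u + 1) := lp (fun r : A.CKRep => r.B) ∞

noncomputable instance : CStarAlgebra A.CKProduct where

variable {A}

theorem IsCKFamily.map {B C : Type*} [Ring B] [StarRing B] [Algebra ℂ B] [Ring C] [StarRing C]
    [Algebra ℂ C] {S : I → B} (hS : A.IsCKFamily S) (φ : B →⋆ₐ[ℂ] C) :
    A.IsCKFamily fun i => φ (S i) where
  partial_isometry i := by rw [← map_star, ← map_mul, ← map_mul, hS.partial_isometry]
  sum_eq_one := by
    simp_rw [← map_star, ← map_mul, ← map_sum, hS.sum_eq_one, map_one]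
  star_mul_self i := by
    simp_rw [← map_star, ← map_mul, ← map_zsmul, ← map_sum, hS.star_mul_self]

theorem IsCKFamily.norm_le_one {B : Type*} [CStarAlgebra B] {S : I → B}
    (hS : A.IsCKFamily S) (i : I) : ‖S i‖ ≤ 1 := by
  have h1 : ‖S i * star (S i)‖ = ‖S i‖ * ‖S i‖ := CStarRing.norm_self_mul_star
  have h2 : ‖(S i * star (S i)) * star (S i * star (S i))‖ =
      ‖S i * star (S i)‖ * ‖S i * star (S i)‖ := CStarRing.norm_self_mul_star
  have h3 : (S i * star (S i)) * star (S i * star (S i)) = S i * star (S i) := by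
    rw [star_mul, star_star, ← mul_assoc, hS.partial_isometry]
  rw [h3, h1] at h2
  by_contra! h
  have : 1 < ‖S i‖ * ‖S i‖ := by nlinarith
  nlinarith

variable (A) in
/-- The universal family: the tuple of all Cuntz-Krieger families. -/
noncomputable def univFamily (i : I) : A.CKProduct :=
  ⟨fun r => r.S i, memℓp_infty ⟨1, by rintro _ ⟨r, rfl⟩; exact r.isCK.norm_le_one i⟩⟩

/-- The projection of the product to one of its factors. -/
noncomputable def CKRep.proj (r : A.CKRep) : A.CKProduct →⋆ₐ[ℂ] r.B where
  toFun x := (x : ∀ r : A.CKRep, r.B) r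
  map_one' := rfl
  map_mul' _ _ := rfl
  map_zero' := rfl
  map_add' _ _ := rfl
  commutes' _ := rfl
  map_star' _ := rfl

theorem CKRep.proj_univFamily (r : A.CKRep) (i : I) : r.proj (A.univFamily i) = r.S i := rfl

theorem CKProduct.ext {x y : A.CKProduct} (h : ∀ r : A.CKRep, r.proj x = r.proj y) : x = y :=
  lp.ext (funext h)

theorem isCKFamily_univFamily : A.IsCKFamily A.univFamily where
  partial_isometry i := CKProduct.ext fun r => by
    simpa only [CKRep.proj_univFamily, map_mul, map_star] using r.isCK.partial_isometry i
  sum_eq_one := CKProduct.ext fun r => by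
    simpa only [CKRep.proj_univFamily, map_mul, map_star, map_sum, map_one] using r.isCK.sum_eq_one
  star_mul_self i := CKProduct.ext fun r => by
    simpa only [CKRep.proj_univFamily, map_mul, map_star, map_sum, map_zsmul] using r.isCK.star_mul_self i

variable (A) in
/-- The Cuntz-Krieger algebra `O_A`, the universal unital C⋆-algebra generated by a Cuntz-Krieger
family, realised as the closed `*`-subalgebra generated by the universal family in the product of
all Cuntz-Krieger families; `exists_lift` and `hom_ext` below are its universal property. -/
noncomputable def ckSubalgebra : StarSubalgebra ℂ A.CKProduct :=
  (StarAlgebra.adjoin ℂ (range A.univFamily)).topologicalClosure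

instance : IsClosed (A.ckSubalgebra : Set A.CKProduct) :=
  StarSubalgebra.isClosed_topologicalClosure _

variable (A) in
/-- The Cuntz-Krieger algebra `O_A` as a type. -/
abbrev CKAlgebra : Type (u + 1) := A.ckSubalgebra

variable (A) in
/-- The generators `S_i` of `O_A`. -/
noncomputable def gen (i : I) : A.CKAlgebra :=
  ⟨A.univFamily i, StarSubalgebra.le_topologicalClosure _
    (StarAlgebra.subset_adjoin ℂ _ (mem_range_self i))⟩

theorem isCKFamily_gen : A.IsCKFamily A.gen where
  partial_isometry i := Subtype.ext (isCKFamily_univFamily.partial_isometry i)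
  sum_eq_one := Subtype.ext <| by
    simpa using! isCKFamily_univFamily.sum_eq_one (A := A)
  star_mul_self i := Subtype.ext <| by
    simpa using! isCKFamily_univFamily.star_mul_self (A := A) i

/-- Two `*`-homomorphisms on `O_A` that agree on the generators are equal. -/
theorem hom_ext {C : Type*} [CStarAlgebra C] {φ ψ : A.CKAlgebra →⋆ₐ[ℂ] C}
    (h : ∀ i, φ (A.gen i) = ψ (A.gen i)) : φ = ψ := by
  have hφ : Continuous φ := map_continuous φ
  have hψ : Continuous ψ := map_continuous ψ
  refine StarAlgHom.ext_topologicalClosure hφ hψ ?_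
  refine StarAlgHom.ext_adjoin ?_
  rintro ⟨_, hx⟩ ⟨i, rfl⟩
  exact h i

/-- Every Cuntz-Krieger family in `O_A` comes from an endomorphism. -/
theorem exists_endo {T : I → A.CKAlgebra} (hT : A.IsCKFamily T) :
    ∃ φ : A.CKAlgebra →⋆ₐ[ℂ] A.CKAlgebra, ∀ i, φ (A.gen i) = T i := by
  let T' : (r : A.CKRep) → A.CKRep := fun r =>
    { B := r.B
      S := fun i => r.proj (T i)
      isCK := hT.map (r.proj.comp A.ckSubalgebra.subtype) }
  let Φ : A.CKProduct →⋆ₐ[ℂ] A.CKProduct :=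
    { toFun := fun x => ⟨fun r => (T' r).proj x, memℓp_infty ⟨‖x‖, by
        rintro _ ⟨r, rfl⟩; exact lp.norm_apply_le_norm ENNReal.top_ne_zero x (T' r)⟩⟩
      map_one' := rfl
      map_mul' := fun _ _ => rfl
      map_zero' := rfl
      map_add' := fun _ _ => rfl
      commutes' := fun _ => rfl
      map_star' := fun _ => rfl }
  have hΦ : ∀ i, Φ (A.univFamily i) = T i := fun i => CKProduct.ext fun r => rfl
  have hc : Continuous Φ := map_continuous Φ
  have hle : A.ckSubalgebra ≤ A.ckSubalgebra.comap Φ := by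
    refine StarSubalgebra.topologicalClosure_minimal ?_ ?_
    · refine StarAlgebra.adjoin_le ?_
      rintro _ ⟨i, rfl⟩
      change Φ (A.univFamily i) ∈ A.ckSubalgebra
      rw [hΦ]
      exact (T i).2
    · exact (StarSubalgebra.isClosed_topologicalClosure _).preimage hc
  refine ⟨(Φ.comp A.ckSubalgebra.subtype).codRestrict A.ckSubalgebra fun x => hle x.2, fun i => ?_⟩
  exact Subtype.ext (hΦ i)

/-- The universal property of `O_A`. -/
theorem exists_lift {B : Type u} [CStarAlgebra B] {T : I → B} (hT : A.IsCKFamily T) :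
    ∃ φ : A.CKAlgebra →⋆ₐ[ℂ] B, ∀ i, φ (A.gen i) = T i := by
  rcases subsingleton_or_nontrivial B with hB | hB
  · exact ⟨{ toFun := fun _ => 0
             map_one' := Subsingleton.elim _ _
             map_mul' := fun _ _ => Subsingleton.elim _ _
             map_zero' := rfl
             map_add' := fun _ _ => Subsingleton.elim _ _
             commutes' := fun _ => Subsingleton.elim _ _
             map_star' := fun _ => Subsingleton.elim _ _ }, fun _ => Subsingleton.elim _ _⟩
  · let r : A.CKRep := { B := B, S := T, isCK := hT }
    exact ⟨r.proj.comp A.ckSubalgebra.subtype, fun i => rfl⟩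

end Families

/-! ### The embedding of `C(Σ_A)` in `O_A` -/

section Diagonal

open scoped CStarAlgebra

variable {A}

/-- The product `S_w = S_{w₀} S_{w₁} ⋯ S_{w_{n-1}}` along a finite word. -/
def wordProd {B : Type*} [Monoid B] (S : I → B) (w : List I) : B := (w.map S).prod

theorem wordProd_cons {B : Type*} [Monoid B] (S : I → B) (i : I) (w : List I) :
    wordProd S (i :: w) = S i * wordProd S w := by simp [wordProd]

theorem wordProd_append {B : Type*} [Monoid B] (S : I → B) (v w : List I) :
    wordProd S (v ++ w) = wordProd S v * wordProd S w := by simp [wordProd]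

/-- The element `S_w S_w^*`. -/
def wordProj {B : Type*} [Monoid B] [Star B] (S : I → B) (w : List I) : B :=
  wordProd S w * star (wordProd S w)

theorem wordProj_append {B : Type*} [Monoid B] [StarMul B] (S : I → B) (v w : List I) :
    wordProj S (v ++ w) = wordProd S v * wordProj S w * star (wordProd S v) := by
  simp only [wordProj, wordProd_append, star_mul, mul_assoc]

theorem wordProj_cons {B : Type*} [Monoid B] [StarMul B] (S : I → B) (i : I) (w : List I) :
    wordProj S (i :: w) = S i * wordProj S w * star (S i) := by
  simp only [wordProj, wordProd_cons, star_mul, mul_assoc]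

theorem star_wordProj {B : Type*} [Monoid B] [StarMul B] (S : I → B) (w : List I) :
    star (wordProj S w) = wordProj S w := by
  rw [wordProj, star_mul, star_star]

namespace IsCKFamily

variable [Fintype I] {B : Type*} [CStarAlgebra B] {S : I → B}

theorem proj_mul_proj (hS : A.IsCKFamily S) {i j : I} (hij : i ≠ j) :
    (S i * star (S i)) * (S j * star (S j)) = 0 := by
  classical
  let _ := CStarAlgebra.spectralOrder B
  have := CStarAlgebra.spectralOrderedRing B
  have hidem : ∀ k, (S k * star (S k)) * (S k * star (S k)) = S k * star (S k) := fun k => by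
    rw [← mul_assoc, hS.partial_isometry]
  have hterm : ∀ k, star ((S k * star (S k)) * (S j * star (S j))) *
      ((S k * star (S k)) * (S j * star (S j))) =
      (S j * star (S j)) * (S k * star (S k)) * (S j * star (S j)) := fun k => by
    rw [star_mul, star_mul, star_mul, star_star, star_star,
      mul_assoc (S j * star (S j)), ← mul_assoc (S k * star (S k)) (S k * star (S k)), hidem,
      ← mul_assoc]
  have hsum : ∑ k, star ((S k * star (S k)) * (S j * star (S j))) *
      ((S k * star (S k)) * (S j * star (S j))) = S j * star (S j) := by
    simp_rw [hterm]
    rw [← Finset.sum_mul, ← Finset.mul_sum, hS.sum_eq_one, mul_one, hidem]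
  rw [← Finset.add_sum_erase _ _ (Finset.mem_univ j), hterm, hidem, hidem,
    add_eq_left, Finset.sum_eq_zero_iff_of_nonneg (fun k _ => star_mul_self_nonneg _)] at hsum
  have := hsum i (Finset.mem_erase.2 ⟨hij, Finset.mem_univ i⟩)
  exact (CStarRing.star_mul_self_eq_zero_iff _).1 this

theorem proj_mul_of_ne (hS : A.IsCKFamily S) {i j : I} (hij : i ≠ j) :
    (S i * star (S i)) * S j = 0 := by
  rw [← hS.partial_isometry j, ← mul_assoc, hS.proj_mul_proj hij, zero_mul]

theorem star_mul_of_ne (hS : A.IsCKFamily S) {i j : I} (hij : i ≠ j) :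
    star (S i) * S j = 0 := by
  have h : star (S i) = star (S i) * (S i * star (S i)) := by
    conv_lhs => rw [← hS.partial_isometry i, star_mul, star_mul, star_star]
  rw [h, mul_assoc, hS.proj_mul_of_ne hij, mul_zero]

theorem star_mul_self_mul (hS : A.IsCKFamily S) (i j : I) :
    star (S i) * S i * S j = A.mat i j • S j := by
  classical
  rw [hS.star_mul_self, Finset.sum_mul, Finset.sum_eq_single j]
  · rw [smul_mul_assoc, hS.partial_isometry]
  · intro k _ hk
    rw [smul_mul_assoc, hS.proj_mul_of_ne hk, smul_zero]
  · simp

theorem mul_eq_zero (hS : A.IsCKFamily S) {i j : I} (hij : A.mat i j = 0) : S i * S j = 0 := by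
  have := hS.star_mul_self_mul i j
  rw [hij, zero_smul] at this
  rw [← hS.partial_isometry i, mul_assoc (S i), mul_assoc, this, mul_zero]

theorem star_wordProd_mul (hS : A.IsCKFamily S) :
    ∀ {v w : List I}, v.length = w.length → v ≠ w → star (wordProd S v) * wordProd S w = 0
  | [], [], _, h => absurd rfl h
  | [], _ :: _, h, _ => by simp at h
  | _ :: _, [], h, _ => by simp at h
  | i :: v, j :: w, hl, hne => by
    rw [wordProd_cons, wordProd_cons, star_mul, mul_assoc, ← mul_assoc (star (S i))]
    by_cases hij : i = j
    · subst hij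
      have hvw : v ≠ w := fun h => hne (by rw [h])
      have hl' : v.length = w.length := by simpa using hl
      have ih := star_wordProd_mul hS hl' hvw
      cases w with
      | nil => exact absurd (List.eq_nil_of_length_eq_zero hl') hvw
      | cons k w =>
        rw [wordProd_cons, ← mul_assoc (star (S i) * S i), hS.star_mul_self_mul, smul_mul_assoc,
          mul_smul_comm, ← wordProd_cons, ih, smul_zero]
    · rw [hS.star_mul_of_ne hij, zero_mul, mul_zero]

theorem sum_wordProj (hS : A.IsCKFamily S) (n : ℕ) :
    ∑ u : Fin n → I, wordProj S (List.ofFn u) = 1 := by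
  induction n with
  | zero => simp [wordProj, wordProd]
  | succ n ih =>
    rw [← (Fin.consEquiv fun _ : Fin (n + 1) => I).sum_comp, Fintype.sum_prod_type]
    have e : ∀ (i : I) (u : Fin n → I),
        wordProj S (List.ofFn ((Fin.consEquiv fun _ : Fin (n + 1) => I) (i, u))) =
          S i * wordProj S (List.ofFn u) * star (S i) := fun i u => by
      rw [← wordProj_cons, ← List.ofFn_cons]
      rfl
    simp only [e]
    simp_rw [← Finset.sum_mul, ← Finset.mul_sum, ih, mul_one]
    exact hS.sum_eq_one

theorem wordProj_mul (hS : A.IsCKFamily S) {n : ℕ} (u v : Fin n → I) (h : u ≠ v) :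
    wordProj S (List.ofFn u) * wordProj S (List.ofFn v) = 0 := by
  rw [wordProj, wordProj, mul_assoc, ← mul_assoc (star _), hS.star_wordProd_mul (by simp)
    (fun e => h (List.ofFn_injective e)), zero_mul, mul_zero]

theorem wordProj_mul_self (hS : A.IsCKFamily S) {n : ℕ} (u : Fin n → I) :
    wordProj S (List.ofFn u) * wordProj S (List.ofFn u) = wordProj S (List.ofFn u) := by
  classical
  conv_rhs => rw [← mul_one (wordProj S (List.ofFn u)), ← hS.sum_wordProj n, Finset.mul_sum]
  rw [Finset.sum_eq_single u]
  · intro v _ hv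
    exact hS.wordProj_mul _ _ (Ne.symm hv)
  · simp

theorem wordProj_mul_wordProd (hS : A.IsCKFamily S) (w : List I) :
    wordProj S w * wordProd S w = wordProd S w := by
  have hp : wordProj S w * wordProj S w = wordProj S w := by
    have := hS.wordProj_mul_self w.get
    rwa [List.ofFn_get] at this
  have : (wordProj S w * wordProd S w - wordProd S w) *
      star (wordProj S w * wordProd S w - wordProd S w) = 0 := by
    have e : wordProj S w * wordProd S w - wordProd S w = (wordProj S w - 1) * wordProd S w := by
      rw [sub_mul, one_mul]
    rw [e, star_mul, mul_assoc, ← mul_assoc (wordProd S w)]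
    change (wordProj S w - 1) * (wordProj S w * _) = 0
    rw [← mul_assoc, sub_mul, hp, one_mul, sub_self, zero_mul]
  exact sub_eq_zero.1 ((CStarRing.mul_star_self_eq_zero_iff _).1 this)

theorem exists_start (j : I) : ∃ x : A.Shift, x.letter 0 = j := by
  choose r hr using A.row
  refine ⟨⟨fun n => r^[n] j, fun n => ?_⟩, rfl⟩
  change A.mat (r^[n] j) (r^[n + 1] j) = 1
  rw [Function.iterate_succ_apply']
  exact hr _

theorem nonempty_cylinder_or [Nonempty I] (hS : A.IsCKFamily S) :
    ∀ w : List I, (Shift.cylinder w : Set A.Shift).Nonempty ∨ wordProd S w = 0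
  | [] => by
    obtain ⟨x, _⟩ := exists_start (A := A) (Classical.arbitrary I)
    exact Or.inl ⟨x, fun n => n.elim0⟩
  | i :: w => by
    have key : ∀ x ∈ (Shift.cylinder w : Set A.Shift), ∀ h : A.mat i (x.letter 0) = 1,
        Shift.cons i x h ∈ (Shift.cylinder (i :: w) : Set A.Shift) := by
      intro x hx h n
      refine Fin.cases rfl (fun m => ?_) n
      exact hx m
    rcases nonempty_cylinder_or hS w with ⟨x, hx⟩ | h0
    · cases w with
      | nil =>
        obtain ⟨j, hj⟩ := A.row i
        obtain ⟨y, rfl⟩ := exists_start (A := A) j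
        exact Or.inl ⟨_, key y (fun n => n.elim0) hj⟩
      | cons k w =>
        have hk : x.letter 0 = k := hx ⟨0, by simp⟩
        rcases A.zero_or_one i k with h | h
        · right
          rw [wordProd_cons, wordProd_cons, ← mul_assoc, hS.mul_eq_zero h, zero_mul]
        · exact Or.inl ⟨_, key x hx (by rw [hk, h])⟩
    · right
      rw [wordProd_cons, h0, mul_zero]

variable [TopologicalSpace I] [DiscreteTopology I]

/-- Evaluation of a function at one point of each cylinder set of length `n`. -/
noncomputable def approx (hS : A.IsCKFamily S) (p : List I → A.Shift) (n : ℕ) :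
    C(A.Shift, ℂ) →⋆ₐ[ℂ] B where
  toFun f := ∑ u : Fin n → I, f (p (List.ofFn u)) • wordProj S (List.ofFn u)
  map_one' := by simpa using hS.sum_wordProj n
  map_mul' f g := by
    classical
    rw [Finset.sum_mul]
    refine Finset.sum_congr rfl fun u _ => ?_
    rw [Finset.mul_sum, Finset.sum_eq_single u]
    · rw [smul_mul_smul_comm, hS.wordProj_mul_self, ContinuousMap.mul_apply]
    · intro v _ hv
      rw [smul_mul_smul_comm, hS.wordProj_mul _ _ (Ne.symm hv), smul_zero]
    · simp
  map_zero' := by simp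
  map_add' f g := by simp [add_smul, Finset.sum_add_distrib]
  commutes' c := by
    have e : ∀ x : A.Shift, (algebraMap ℂ C(A.Shift, ℂ) c) x = c := fun x => by
      simp [Algebra.algebraMap_eq_smul_one]
    simp only [e]
    rw [← Finset.smul_sum, hS.sum_wordProj, Algebra.algebraMap_eq_smul_one]
  map_star' f := by simp [star_sum, star_wordProj]

theorem approx_cylInd [Nonempty I] (hS : A.IsCKFamily S) (p : List I → A.Shift)
    (hp : ∀ w, (Shift.cylinder w : Set A.Shift).Nonempty → p w ∈ Shift.cylinder w)
    (w : List I) (n : ℕ) (hn : w.length ≤ n) :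
    hS.approx p n (Shift.cylInd w) = wordProj S w := by
  classical
  have key : ∀ u : Fin n → I, Shift.cylInd w (p (List.ofFn u)) • wordProj S (List.ofFn u) =
      wordProj S w * wordProj S (List.ofFn u) := by
    intro u
    rcases hS.nonempty_cylinder_or (List.ofFn u) with h | h
    swap
    · simp [wordProj, h]
    have hm := hp _ h
    set L := List.ofFn u with hL
    have hLn : L.length = n := by simp [hL]
    have hsplit : L = L.take w.length ++ L.drop w.length := (List.take_append_drop _ _).symm
    have hmem : p L ∈ (Shift.cylinder w : Set A.Shift) ↔ L.take w.length = w := by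
      constructor
      · intro h1
        refine List.ext_get (by simp [hLn, hn]) fun m h2 h3 => ?_
        have e1 := h1 ⟨m, h3⟩
        have e2 := hm ⟨m, by omega⟩
        simp only [List.get_eq_getElem] at e1 e2 ⊢
        rw [List.getElem_take, ← e1, ← e2]
      · intro h1 m
        have e2 := hm ⟨m, by omega⟩
        simp only [List.get_eq_getElem] at e2 ⊢
        rw [e2]
        have : (L.take w.length)[(m : ℕ)]'(by rw [h1]; exact m.2) = w[(m : ℕ)] := by
          simp only [h1]
        rw [← this, List.getElem_take]
    rw [Shift.cylInd_apply]
    by_cases h1 : L.take w.length = w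
    · rw [indicator_of_mem (hmem.2 h1), hsplit, h1, wordProj_append, ← mul_assoc, ← mul_assoc,
        hS.wordProj_mul_wordProd]
      simp
    · rw [indicator_of_notMem (fun h => h1 (hmem.1 h)), zero_smul]
      have h0 : star (wordProd S w) * wordProd S (L.take w.length) = 0 :=
        hS.star_wordProd_mul (by simp [hLn, hn]) (Ne.symm h1)
      rw [hsplit, wordProj_append, ← mul_assoc, ← mul_assoc, wordProj, mul_assoc (wordProd S w),
        h0]
      simp
  change ∑ u : Fin n → I, Shift.cylInd w (p (List.ofFn u)) • wordProj S (List.ofFn u) = _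
  simp_rw [key]
  rw [← Finset.mul_sum, hS.sum_wordProj, mul_one]

variable (A) in
theorem adjoin_cylInd :
    (StarAlgebra.adjoin ℂ (range (Shift.cylInd : List I → C(A.Shift, ℂ)))).topologicalClosure =
      ⊤ := by
  apply ContinuousMap.starSubalgebra_topologicalClosure_eq_top_of_separatesPoints
  intro x y hxy
  have : ∃ n, x.letter n ≠ y.letter n := by
    by_contra! h
    exact hxy (Shift.ext h)
  obtain ⟨n, hn⟩ := this
  let w : List I := List.ofFn fun m : Fin (n + 1) => x.letter m
  refine ⟨_, ⟨Shift.cylInd w, StarAlgebra.subset_adjoin ℂ _ (mem_range_self w), rfl⟩, ?_⟩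
  have hx : x ∈ (Shift.cylinder w : Set A.Shift) := by
    intro m; simp only [w, List.get_ofFn]; rfl
  have hy : y ∉ (Shift.cylinder w : Set A.Shift) := by
    intro h
    have := h ⟨n, by simp [w]⟩
    simp only [w, List.get_ofFn] at this
    exact hn this.symm
  simp only [Shift.cylInd_apply, indicator_of_mem hx, indicator_of_notMem hy]
  simp

theorem exists_unique_diag [Nonempty I] (hS : A.IsCKFamily S) :
    ∃! ψ : C(A.Shift, ℂ) →⋆ₐ[ℂ] B, ∀ w, ψ (Shift.cylInd w) = wordProj S w := by
  classical
  refine existsUnique_of_exists_of_unique ?_ ?_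
  · obtain ⟨x₀, -⟩ := exists_start (A := A) (Classical.arbitrary I)
    let p : List I → A.Shift := fun w =>
      if h : (Shift.cylinder w : Set A.Shift).Nonempty then h.some else x₀
    have hp : ∀ w, (Shift.cylinder w : Set A.Shift).Nonempty → p w ∈ Shift.cylinder w := by
      intro w h
      simp only [p, dif_pos h]
      exact h.some_mem
    let T : StarSubalgebra ℂ C(A.Shift, ℂ) :=
      { carrier := {f | ∃ b, Tendsto (fun n => hS.approx p n f) atTop (𝓝 b)}
        mul_mem' := by
          rintro f g ⟨b, hb⟩ ⟨c, hc⟩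
          exact ⟨b * c, by simpa only [map_mul] using hb.mul hc⟩
        add_mem' := by
          rintro f g ⟨b, hb⟩ ⟨c, hc⟩
          exact ⟨b + c, by simpa only [map_add] using hb.add hc⟩
        algebraMap_mem' := fun c => ⟨algebraMap ℂ B c, by
          simpa only [AlgHomClass.commutes] using tendsto_const_nhds⟩
        star_mem' := by
          rintro f ⟨b, hb⟩
          exact ⟨star b, by simpa only [map_star] using hb.star⟩ }
    have hTc : IsClosed (T : Set C(A.Shift, ℂ)) := by
      refine isClosed_of_closure_subset fun f hf => ?_
      refine cauchySeq_tendsto_of_complete (Metric.cauchySeq_iff.2 fun ε hε => ?_)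
      obtain ⟨g, ⟨b, hb⟩, hg⟩ := Metric.mem_closure_iff.1 hf (ε / 3) (by positivity)
      obtain ⟨N, hN⟩ := Metric.cauchySeq_iff.1 hb.cauchySeq (ε / 3) (by positivity)
      refine ⟨N, fun m hm n hn => ?_⟩
      have hd : ∀ k, dist (hS.approx p k f) (hS.approx p k g) < ε / 3 := fun k => by
        rw [dist_eq_norm, ← map_sub]
        refine (NonUnitalStarAlgHom.norm_apply_le _ _).trans_lt ?_
        rwa [← dist_eq_norm]
      calc dist (hS.approx p m f) (hS.approx p n f)
          ≤ dist (hS.approx p m f) (hS.approx p m g) + dist (hS.approx p m g) (hS.approx p n g)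
            + dist (hS.approx p n g) (hS.approx p n f) := dist_triangle4 _ _ _ _
        _ < ε / 3 + ε / 3 + ε / 3 := by
            have h1 := hd m
            have h2 := hN m hm n hn
            have h3 := hd n
            rw [dist_comm] at h3
            linarith
        _ = ε := by ring
    have hcyl : ∀ w, Tendsto (fun n => hS.approx p n (Shift.cylInd w)) atTop
        (𝓝 (wordProj S w)) := fun w =>
      tendsto_const_nhds.congr' <| by
        filter_upwards [eventually_ge_atTop w.length] with n hn
        exact (hS.approx_cylInd p hp w n hn).symm
    have hT : ∀ f, f ∈ T := by
      intro f
      have hle : StarAlgebra.adjoin ℂ (range (Shift.cylInd : List I → C(A.Shift, ℂ))) ≤ T := by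
        refine StarAlgebra.adjoin_le ?_
        rintro _ ⟨w, rfl⟩
        exact ⟨_, hcyl w⟩
      have := StarSubalgebra.topologicalClosure_minimal hle hTc
      rw [adjoin_cylInd] at this
      exact this trivial
    choose b hb using hT
    refine ⟨{ toFun := b
              map_one' := tendsto_nhds_unique (hb 1) (by simp)
              map_mul' := fun f g => tendsto_nhds_unique (hb _) (by
                simpa only [map_mul] using (hb f).mul (hb g))
              map_zero' := tendsto_nhds_unique (hb 0) (by simp)
              map_add' := fun f g => tendsto_nhds_unique (hb _) (by
                simpa only [map_add] using (hb f).add (hb g))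
              commutes' := fun c => tendsto_nhds_unique (hb _) (by
                simpa only [AlgHomClass.commutes] using tendsto_const_nhds)
              map_star' := fun f => tendsto_nhds_unique (hb _) (by
                simpa only [map_star] using (hb f).star) }, fun w => ?_⟩
    exact tendsto_nhds_unique (hb _) (hcyl w)
  · intro φ ψ hφ hψ
    have hφc : Continuous φ := map_continuous φ
    have hψc : Continuous ψ := map_continuous ψ
    have hd : Dense ((StarAlgebra.adjoin ℂ (range (Shift.cylInd : List I → C(A.Shift, ℂ))) :
        StarSubalgebra ℂ C(A.Shift, ℂ)) : Set C(A.Shift, ℂ)) := by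
      rw [dense_iff_closure_eq, ← StarSubalgebra.topologicalClosure_coe, adjoin_cylInd]
      rfl
    have he : EqOn φ ψ (StarAlgebra.adjoin ℂ (range (Shift.cylInd : List I → C(A.Shift, ℂ))) :
        StarSubalgebra ℂ C(A.Shift, ℂ)) := by
      have := StarAlgHom.adjoin_le_equalizer φ ψ
        (s := range (Shift.cylInd : List I → C(A.Shift, ℂ)))
        (by rintro _ ⟨w, rfl⟩; rw [hφ, hψ])
      exact fun f hf => this hf
    exact DFunLike.ext' (Continuous.ext_on hd hφc hψc he)

end IsCKFamily

end Diagonal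

section KMS

variable [Fintype I] [Nonempty I] [TopologicalSpace I] [DiscreteTopology I]

/-- The embedding `ψ : C(Σ_A) → O_A`, the unique `*`-homomorphism with `ψ(1_{[w]}) = S_w S_w^*`
for all finite words `w`. -/
noncomputable def diag : C(A.Shift, ℂ) →⋆ₐ[ℂ] A.CKAlgebra :=
  (isCKFamily_gen (A := A)).exists_unique_diag.choose

theorem diag_cylInd (w : List I) : A.diag (Shift.cylInd w) = wordProj A.gen w :=
  (isCKFamily_gen (A := A)).exists_unique_diag.choose_spec.1 w

variable {A}

theorem diag_unique {ψ : C(A.Shift, ℂ) →⋆ₐ[ℂ] A.CKAlgebra}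
    (h : ∀ w, ψ (Shift.cylInd w) = wordProj A.gen w) : ψ = A.diag :=
  (isCKFamily_gen (A := A)).exists_unique_diag.unique h A.diag_cylInd

/-- The function `e^{itH}` on `Σ_A`. -/
noncomputable def phase (H : C(A.Shift, ℝ)) (t : ℝ) : C(A.Shift, ℂ) where
  toFun x := Complex.exp (Complex.I * t * H x)
  continuous_toFun := by fun_prop

theorem phase_add (H : C(A.Shift, ℝ)) (s t : ℝ) : phase H (s + t) = phase H s * phase H t := by
  ext x
  simp only [phase, ContinuousMap.coe_mk, ContinuousMap.mul_apply, ← Complex.exp_add]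
  congr 1
  push_cast
  ring

theorem phase_zero (H : C(A.Shift, ℝ)) : phase H 0 = 1 := by
  ext x
  simp [phase]

theorem star_phase (H : C(A.Shift, ℝ)) (t : ℝ) : star (phase H t) = phase H (-t) := by
  ext x
  simp [phase, ← Complex.exp_conj]

theorem star_phase_mul (H : C(A.Shift, ℝ)) (t : ℝ) : star (phase H t) * phase H t = 1 := by
  rw [star_phase, ← phase_add, neg_add_cancel, phase_zero]

theorem phase_conj (H : C(A.Shift, ℝ)) (t : ℝ) (w : List I) :
    A.diag (phase H t) * wordProj A.gen w * star (A.diag (phase H t)) = wordProj A.gen w := by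
  rw [← diag_cylInd, ← map_star, ← map_mul, ← map_mul, mul_comm, ← mul_assoc, star_phase_mul,
    one_mul]

theorem wordProj_singleton (i : I) : wordProj A.gen [i] = A.gen i * star (A.gen i) := by
  simp [wordProj, wordProd]

theorem isCKFamily_phase (H : C(A.Shift, ℝ)) (t : ℝ) :
    A.IsCKFamily fun i => A.diag (phase H t) * A.gen i := by
  have h1 : ∀ i, A.diag (phase H t) * A.gen i * star (A.diag (phase H t) * A.gen i) =
      A.gen i * star (A.gen i) := fun i => by
    rw [star_mul, mul_assoc, ← mul_assoc (A.gen i), ← mul_assoc, ← wordProj_singleton, phase_conj]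
  have h2 : star (A.diag (phase H t)) * A.diag (phase H t) = 1 := by
    rw [← map_star, ← map_mul, star_phase_mul, map_one]
  refine ⟨fun i => ?_, ?_, fun i => ?_⟩
  · rw [h1, ← wordProj_singleton, ← diag_cylInd, ← mul_assoc, ← map_mul, mul_comm, map_mul,
      diag_cylInd, wordProj_singleton, mul_assoc, isCKFamily_gen.partial_isometry]
  · simp_rw [h1]
    exact isCKFamily_gen.sum_eq_one
  · simp_rw [h1]
    rw [star_mul, mul_assoc, ← mul_assoc (star (A.diag _)), h2, one_mul]
    exact isCKFamily_gen.star_mul_self i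

theorem exists_gaugeAction (H : C(A.Shift, ℝ)) (t : ℝ) :
    ∃ α : A.CKAlgebra ≃⋆ₐ[ℂ] A.CKAlgebra, ∀ j, α (A.gen j) = A.diag (phase H t) * A.gen j := by
  choose φ hφ using fun t => exists_endo (isCKFamily_phase H t)
  have hword : ∀ s (w : List I), φ s (wordProj A.gen w) = wordProj A.gen w := by
    intro s w
    induction w with
    | nil => simp [wordProj, wordProd]
    | cons i w ih =>
      rw [wordProj_cons, map_mul, map_mul, map_star, hφ, ih, star_mul, ← mul_assoc,
        mul_assoc _ (A.gen i), mul_assoc _ (A.gen i * _), ← wordProj_cons, phase_conj]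
  have hdiag : ∀ s f, φ s (A.diag f) = A.diag f := by
    intro s f
    have : (φ s).comp A.diag = A.diag := diag_unique fun w => by
      rw [StarAlgHom.comp_apply, diag_cylInd, hword]
    exact DFunLike.congr_fun this f
  have hcomp : ∀ s r, s + r = 0 → ∀ x, φ s (φ r x) = x := by
    intro s r hsr x
    have : (φ s).comp (φ r) = StarAlgHom.id ℂ A.CKAlgebra := hom_ext fun i => by
      rw [StarAlgHom.comp_apply, hφ, map_mul, hdiag, hφ, ← mul_assoc, ← map_mul, ← phase_add,
        add_comm, hsr, phase_zero, map_one, one_mul]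
      rfl
    exact DFunLike.congr_fun this x
  refine ⟨StarAlgEquiv.ofStarAlgHom (φ t) (φ (-t)) ?_ ?_, fun j => ?_⟩
  · exact StarAlgHom.ext (hcomp (-t) t (by simp))
  · exact StarAlgHom.ext (hcomp t (-t) (by simp))
  · exact hφ t j

/-- The gauge action: `α_H^t` is the `*`-automorphism of `O_A` with `α_H^t (S_j) = e^{itH} S_j`
for all `j`. -/
noncomputable def gaugeAction (H : C(A.Shift, ℝ)) (t : ℝ) : A.CKAlgebra ≃⋆ₐ[ℂ] A.CKAlgebra :=
  (exists_gaugeAction H t).choose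

theorem gaugeAction_gen (H : C(A.Shift, ℝ)) (t : ℝ) (j : I) :
    gaugeAction H t (A.gen j) = A.diag (phase H t) * A.gen j :=
  (exists_gaugeAction H t).choose_spec j

open scoped ComplexOrder in
/-- A state on `O_A`: a positive linear functional of norm one. -/
structure IsState (σ : A.CKAlgebra →L[ℂ] ℂ) : Prop where
  norm_eq_one : ‖σ‖ = 1
  nonneg : ∀ X, 0 ≤ σ (star X * X)

/-- The `(H, β)`-KMS states on `O_A`: the states `σ` such that for all `X`, `Y` in a norm-dense
subset there is a function `F`, bounded and continuous on the closed strip between the lines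
`Im z = 0` and `Im z = β` and analytic in its interior, with `F(t) = σ(X α_H^t(Y))` and
`F(t + iβ) = σ(α_H^t(Y) X)` for all real `t`. -/
structure IsKMSState (H : C(A.Shift, ℝ)) (β : ℝ) (σ : A.CKAlgebra →L[ℂ] ℂ) : Prop where
  isState : IsState σ
  exists_dense : ∃ D : Set A.CKAlgebra, Dense D ∧ ∀ X ∈ D, ∀ Y ∈ D, ∃ F : ℂ → ℂ,
    ContinuousOn F {z | z.im ∈ uIcc 0 β} ∧
    DifferentiableOn ℂ F {z | z.im ∈ uIoo 0 β} ∧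
    (∃ C : ℝ, ∀ z : ℂ, z.im ∈ uIcc 0 β → ‖F z‖ ≤ C) ∧
    ∀ t : ℝ, F t = σ (X * gaugeAction H t Y) ∧
      F (t + β * Complex.I) = σ (gaugeAction H t Y * X)

variable (A) in
/-- The set of the `(H, β)`-KMS states on `O_A`. -/
def kmsStates (H : C(A.Shift, ℝ)) (β : ℝ) : Set (A.CKAlgebra →L[ℂ] ℂ) := {σ | IsKMSState H β σ}

/-- The restriction of the functional `σ` to `C(Σ_A)` is integration with respect to `μ`. -/
def RestrictsTo (σ : A.CKAlgebra →L[ℂ] ℂ) (μ : ProbabilityMeasure A.Shift) : Prop :=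
  ∀ f : C(A.Shift, ℂ), σ (A.diag f) = ∫ x, f x ∂(μ : Measure A.Shift)

end KMS

end TransitionMatrix

/-!
A KMS state is first described without analytic functions (`IsModular`): for a state `σ` the KMS
condition is equivalent to the two identities `σ(f X) = σ(X f)` for `f ∈ C(Σ_A)` and
`σ(S_j X) = σ(X e^{-βH} S_j)`, for all `X ∈ O_A`. In one direction (`IsKMSState.isModular`) the
elements `f` and `S_j` have orbits that extend to entire functions, and the three lines theorem
shows that the functions `F` given for approximating pairs in the dense set converge to these
extensions up to the other boundary line of the strip (`boundary_limit_eq_zero`). In the other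
direction (`IsModular.isKMSState`) the elements with an entire orbit that satisfies the KMS identity
form an algebra that contains the generators, and it is dense.

The measure `m_σ` comes from the Riesz representation theorem. As `L_{-βH} f` is equal to
`∑_j S_j^* e^{-βH} f S_j`, the second identity gives `σ(L_{-βH} f) = ∑_j σ(S_j S_j^* f) = σ(f)`, so
`m_σ` is an eigenmeasure.

For surjectivity no conditional expectation onto `C(Σ_A)` is needed. In the representation of `O_A`
on `ℓ²(Σ_A)` with `S_j δ_x = δ_{jx}`, an eigenmeasure `μ` defines the state
`X ↦ ∫ ⟨δ_x, X δ_x⟩ dμ(x)`, whose restriction to `C(Σ_A)` is `μ`. Its integrand is a bounded Borel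
function of `x`, and the second identity is the statement that `μ` has the Jacobian `e^{-βH}` along
the inverse branches of the shift (`integral_cylinder_comp_shift`).

For injectivity let `H ≥ 0`. The elements `S_v f S_w^*` span a dense subspace, and the second
identity reduces the values of `σ` on them to those on `f` and on `f S_u` with a nonempty word `u`
(`IsModular.ext`). On the latter it yields `σ(f S_u) = σ(f e^{-βg} S_u)`, where `g ≥ H` is the
Birkhoff sum of `H` along `u`. So the functional `f ↦ σ(f S_u)`, which by the Cauchy-Schwarz
inequality is continuous for the norm of `L²(m_σ)`, vanishes on the multiples of `1 - e^{-βg}`. If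
`{H = 0}` is a null set, these are dense in `L²(m_σ)`, so `σ(f S_u) = 0`
(`IsModular.map_diag_mul_wordProd_eq_zero`) and `σ` is determined by `m_σ`.
-/

/-! ### Inverse branches of the shift -/

namespace TransitionMatrix

namespace Shift

variable {I : Type u} {A : TransitionMatrix I}

open Classical in
/-- The inverse branch `x ↦ j x` of the shift, extended to a continuous self-map of `Σ_A`: the
words `x` that cannot be preceded by `j` are left unchanged. -/
noncomputable def prepend (j : I) (x : A.Shift) : A.Shift :=
  if h : A.mat j (x.letter 0) = 1 then cons j x h else x

theorem prepend_of_adm {j : I} {x : A.Shift} (h : A.mat j (x.letter 0) = 1) :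
    prepend j x = cons j x h := dif_pos h

theorem shift_prepend {j : I} {x : A.Shift} (h : A.mat j (x.letter 0) = 1) :
    (prepend j x).shift = x := by
  rw [prepend_of_adm h]
  rfl

theorem letter_zero_prepend {j : I} {x : A.Shift} (h : A.mat j (x.letter 0) = 1) :
    (prepend j x).letter 0 = j := by
  rw [prepend_of_adm h]
  rfl

theorem prepend_letter_zero_shift (x : A.Shift) : prepend (x.letter 0) x.shift = x := by
  have h : A.mat (x.letter 0) (x.shift.letter 0) = 1 := x.2 0
  rw [prepend_of_adm h]
  refine ext fun n => ?_
  cases n <;> rfl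

variable [TopologicalSpace I] [DiscreteTopology I]

theorem continuous_shift : Continuous (shift : A.Shift → A.Shift) :=
  continuous_induced_rng.2 (continuous_pi fun n => continuous_letter (n + 1))

theorem continuous_prepend (j : I) : Continuous (prepend j : A.Shift → A.Shift) := by
  classical
  refine continuous_induced_rng.2 (continuous_pi fun n => ?_)
  cases n with
  | zero =>
    have hg : Continuous fun k : I => if A.mat j k = 1 then j else k :=
      continuous_of_discreteTopology
    refine (hg.comp (continuous_letter (A := A) 0)).congr fun x => ?_
    by_cases h : A.mat j (x.letter 0) = 1
    · simp only [h, if_true, Function.comp, prepend_of_adm]; rfl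
    · simp only [h, if_false, Function.comp, prepend, dif_neg, not_false_iff]; rfl
  | succ n =>
    have hg : Continuous fun p : I × I × I => if A.mat j p.1 = 1 then p.2.1 else p.2.2 :=
      continuous_of_discreteTopology
    refine (hg.comp ((continuous_letter (A := A) 0).prodMk
      ((continuous_letter n).prodMk (continuous_letter (n + 1))))).congr fun x => ?_
    by_cases h : A.mat j (x.letter 0) = 1
    · simp only [h, if_true, Function.comp, prepend_of_adm]; rfl
    · simp only [h, if_false, Function.comp, prepend, dif_neg, not_false_iff]; rfl

/-- The composition of a function on `Σ_A` with the inverse branch `x ↦ j x`. Its values at the words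
`x` that cannot be preceded by `j` are irrelevant: they are cut off by `admInd A j` or by `S_j`. -/
noncomputable def branch (j : I) (f : C(A.Shift, ℂ)) : C(A.Shift, ℂ) :=
  f.comp ⟨prepend j, continuous_prepend j⟩

@[simp]
theorem branch_apply (j : I) (f : C(A.Shift, ℂ)) (x : A.Shift) :
    branch j f x = f (prepend j x) := rfl

/-- The composition of a function on `Σ_A` with the shift. -/
noncomputable def compShift (f : C(A.Shift, ℂ)) : C(A.Shift, ℂ) :=
  f.comp ⟨shift, continuous_shift⟩

@[simp]
theorem compShift_apply (f : C(A.Shift, ℂ)) (x : A.Shift) : compShift f x = f x.shift := rfl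

theorem isClopen_admissible (j : I) : IsClopen {x : A.Shift | A.mat j (x.letter 0) = 1} :=
  (isClopen_discrete {k : I | A.mat j k = 1}).preimage (continuous_letter 0)

/-- The indicator function of the set of the words that can be preceded by `j`. -/
noncomputable def admInd (A : TransitionMatrix I) (j : I) : C(A.Shift, ℂ) where
  toFun := {x : A.Shift | A.mat j (x.letter 0) = 1}.indicator 1
  continuous_toFun := IsClopen.continuous_indicator (isClopen_admissible j) continuous_one

theorem admInd_of_adm {j : I} {x : A.Shift} (h : A.mat j (x.letter 0) = 1) :
    admInd A j x = 1 :=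
  indicator_of_mem (s := {x : A.Shift | A.mat j (x.letter 0) = 1}) h _

theorem admInd_of_not_adm {j : I} {x : A.Shift} (h : A.mat j (x.letter 0) ≠ 1) :
    admInd A j x = 0 :=
  indicator_of_notMem (s := {x : A.Shift | A.mat j (x.letter 0) = 1}) h _

theorem mem_cylinder_cons {i : I} {w : List I} {x : A.Shift} :
    x ∈ (cylinder (i :: w) : Set A.Shift) ↔
      x.letter 0 = i ∧ x.shift ∈ (cylinder w : Set A.Shift) := by
  constructor
  · intro h
    exact ⟨h ⟨0, by simp⟩, fun n => h n.succ⟩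
  · rintro ⟨h0, h1⟩ n
    refine Fin.cases h0 (fun m => ?_) n
    exact h1 m

theorem mem_cylinder_nil (x : A.Shift) : x ∈ (cylinder [] : Set A.Shift) := fun n => n.elim0

theorem cylInd_nil : (cylInd [] : C(A.Shift, ℂ)) = 1 := by
  ext x
  rw [cylInd_apply, indicator_of_mem (mem_cylinder_nil x)]
  rfl

theorem star_cylInd (w : List I) : star (cylInd w : C(A.Shift, ℂ)) = cylInd w := by
  classical
  ext x
  rw [ContinuousMap.star_apply, cylInd_apply, indicator_apply]
  split_ifs <;> simp

open Classical in
theorem cylInd_cons_apply (i : I) (w : List I) (x : A.Shift) :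
    cylInd (i :: w) x = if x.letter 0 = i then cylInd w x.shift else 0 := by
  simp only [cylInd_apply, indicator_apply, mem_cylinder_cons]
  split_ifs <;> simp_all

open Classical in
theorem cylInd_singleton_apply (i : I) (x : A.Shift) :
    cylInd [i] x = if x.letter 0 = i then 1 else 0 := by
  rw [cylInd_cons_apply, cylInd_nil]
  rfl

/-- By the Stone-Weierstrass theorem a closed property of continuous functions that is compatible
with the algebra operations holds as soon as it holds for the indicators of cylinder sets. -/
theorem continuousMap_induction [Fintype I] {p : C(A.Shift, ℂ) → Prop}
    (closed : IsClosed {f | p f}) (cyl : ∀ w, p (cylInd w)) (const : ∀ c : ℂ, p (algebraMap ℂ _ c))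
    (add : ∀ f g, p f → p g → p (f + g)) (mul : ∀ f g, p f → p g → p (f * g))
    (f : C(A.Shift, ℂ)) : p f := by
  have h : ∀ f ∈ StarAlgebra.adjoin ℂ (range (cylInd : List I → C(A.Shift, ℂ))),
      p f ∧ p (star f) := by
    intro f hf
    induction hf using StarAlgebra.adjoin_induction with
    | mem f hf =>
      obtain ⟨w, rfl⟩ := hf
      rw [star_cylInd]
      exact ⟨cyl w, cyl w⟩
    | algebraMap c =>
      rw [← algebraMap_star_comm]
      exact ⟨const _, const _⟩
    | add f g _ _ hf hg =>
      rw [star_add]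
      exact ⟨add _ _ hf.1 hg.1, add _ _ hf.2 hg.2⟩
    | mul f g _ _ hf hg =>
      rw [star_mul]
      exact ⟨mul _ _ hf.1 hg.1, mul _ _ hg.2 hf.2⟩
    | star f _ hf =>
      rw [star_star]
      exact ⟨hf.2, hf.1⟩
  have hf : f ∈ (StarAlgebra.adjoin ℂ
      (range (cylInd : List I → C(A.Shift, ℂ)))).topologicalClosure := by
    rw [IsCKFamily.adjoin_cylInd]
    trivial
  rw [← SetLike.mem_coe, StarSubalgebra.topologicalClosure_coe] at hf
  exact closure_minimal (fun g hg => (h g hg).1) closed hf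

/-! ### Borel measures on `Σ_A` -/

instance : TopologicalSpace.PseudoMetrizableSpace A.Shift :=
  Topology.IsInducing.pseudoMetrizableSpace (f := (Subtype.val : A.Shift → ℕ → I)) ⟨rfl⟩

/-- A continuous real function, as a continuous complex function. -/
noncomputable def toComplex (f : C(A.Shift, ℝ)) : C(A.Shift, ℂ) :=
  ⟨fun x => (f x : ℂ), by fun_prop⟩

@[simp]
theorem toComplex_apply (f : C(A.Shift, ℝ)) (x : A.Shift) : toComplex f x = (f x : ℂ) := rfl

theorem integrable_continuousMap [Fintype I] (μ : Measure A.Shift) [IsFiniteMeasure μ]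
    (f : C(A.Shift, ℂ)) : Integrable f μ := by
  have : OpensMeasurableSpace A.Shift := inferInstance
  exact f.continuous.integrable_of_hasCompactSupport (HasCompactSupport.of_compactSpace f)

theorem measure_ext [Fintype I] {μ ν : Measure A.Shift} [IsFiniteMeasure μ] [IsFiniteMeasure ν]
    (h : ∀ f : C(A.Shift, ℂ), ∫ x, f x ∂μ = ∫ x, f x ∂ν) : μ = ν := by
  refine ext_of_forall_integral_eq_of_IsFiniteMeasure fun f => ?_
  have := h (toComplex f.toContinuousMap)
  simp only [toComplex_apply, integral_complex_ofReal] at this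
  exact_mod_cast this

/-! ### The complex powers of `e^{iH}` and the Perron-Frobenius operator -/

/-- The function `e^{izH}` on `Σ_A` for a complex number `z`. -/
noncomputable def cphase (H : C(A.Shift, ℝ)) (z : ℂ) : C(A.Shift, ℂ) where
  toFun x := Complex.exp (Complex.I * z * H x)
  continuous_toFun := by fun_prop

@[simp]
theorem cphase_apply (H : C(A.Shift, ℝ)) (z : ℂ) (x : A.Shift) :
    cphase H z x = Complex.exp (Complex.I * z * H x) := rfl

theorem cphase_ofReal [Fintype I] [Nonempty I] (H : C(A.Shift, ℝ)) (t : ℝ) :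
    cphase H t = phase H t := rfl

theorem cphase_add (H : C(A.Shift, ℝ)) (z w : ℂ) : cphase H (z + w) = cphase H z * cphase H w := by
  ext x
  simp only [cphase_apply, ContinuousMap.mul_apply, ← Complex.exp_add]
  congr 1
  ring

theorem cphase_zero (H : C(A.Shift, ℝ)) : cphase H 0 = 1 := by
  ext x
  simp

theorem star_cphase_mul_I (H : C(A.Shift, ℝ)) (β : ℝ) :
    star (cphase H (β * Complex.I)) = cphase H (β * Complex.I) := by
  ext x
  simp only [ContinuousMap.star_apply, cphase_apply, Complex.star_def, ← Complex.exp_conj]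
  simp

theorem cphase_mul_I_apply (H : C(A.Shift, ℝ)) (β : ℝ) (x : A.Shift) :
    cphase H (β * Complex.I) x = (Real.exp (-(β * H x)) : ℝ) := by
  rw [cphase_apply, Complex.ofReal_exp]
  congr 1
  push_cast
  linear_combination (β * H x : ℂ) * Complex.I_mul_I

theorem norm_cphase_le [Fintype I] (H : C(A.Shift, ℝ)) (z : ℂ) :
    ‖cphase H z‖ ≤ Real.exp (|z.im| * ‖H‖) := by
  refine (ContinuousMap.norm_le _ (Real.exp_pos _).le).2 fun x => ?_
  rw [cphase_apply, Complex.norm_exp]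
  refine Real.exp_le_exp.2 ?_
  have : (Complex.I * z * H x).re = -(z.im * H x) := by simp
  rw [this]
  calc -(z.im * H x) ≤ |z.im * H x| := neg_le_abs _
    _ = |z.im| * |H x| := abs_mul _ _
    _ ≤ |z.im| * ‖H‖ := by
      gcongr
      exact H.norm_coe_le_norm x

theorem differentiable_cphase [Fintype I] (H : C(A.Shift, ℝ)) : Differentiable ℂ (cphase H) := by
  have h : cphase H = fun z : ℂ => NormedSpace.exp (z • (Complex.I • toComplex H)) := by
    funext z
    ext x
    let ev : C(A.Shift, ℂ) →+* ℂ := (ContinuousMap.evalStarAlgHom ℂ ℂ x : C(A.Shift, ℂ) →+* ℂ)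
    have hev : Continuous ev := continuous_eval_const x
    have := NormedSpace.map_exp ev hev (z • (Complex.I • toComplex H))
    change _ = ev _
    rw [this, ← Complex.exp_eq_exp_ℂ]
    change Complex.exp _ = Complex.exp (z * (Complex.I * H x))
    congr 1
    ring
  rw [h]
  exact fun z => (hasDerivAt_exp_smul_const _ z).differentiableAt

open Classical in
theorem perronFrobenius_eq_sum [Fintype I] (H : C(A.Shift, ℝ)) (β : ℝ) (f : C(A.Shift, ℂ)) :
    perronFrobenius (-(β • H)) f =
      ∑ j, admInd A j * branch j (cphase H (β * Complex.I) * f) := by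
  ext x
  have h1 : perronFrobenius (-(β • H)) f x = ∑ᶠ y ∈ (shift ⁻¹' {x} : Set A.Shift),
      (cphase H (β * Complex.I) * f) y := by
    change ∑ᶠ y ∈ (shift ⁻¹' {x} : Set A.Shift), _ = _
    refine finsum_congr fun y => finsum_congr fun _ => ?_
    rw [ContinuousMap.mul_apply, cphase_mul_I_apply]
    rfl
  rw [h1, finsum_preimage, ContinuousMap.sum_apply]
  refine Finset.sum_congr rfl fun j _ => ?_
  rw [ContinuousMap.mul_apply, branch_apply]
  split_ifs with h
  · rw [admInd_of_adm h, prepend_of_adm h, one_mul]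
  · rw [admInd_of_not_adm h, zero_mul]

end Shift

end TransitionMatrix

namespace TransitionMatrix

open Shift
open scoped CStarAlgebra

variable {I : Type u} [Fintype I] {A : TransitionMatrix I}

/-! ### Relations in the Cuntz-Krieger algebra -/

theorem dense_adjoin_gen :
    Dense (StarAlgebra.adjoin ℂ (range A.gen) : Set A.CKAlgebra) := by
  have himg : Subtype.val '' (StarAlgebra.adjoin ℂ (range A.gen) : Set A.CKAlgebra) =
      (StarAlgebra.adjoin ℂ (range A.univFamily) : Set A.CKProduct) := by
    have := (A.ckSubalgebra.subtype).map_adjoin (range A.gen)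
    rw [← range_comp] at this
    exact congrArg SetLike.coe this
  refine Subtype.dense_iff.2 ?_
  exact (StarSubalgebra.topologicalClosure_coe _).le.trans (congrArg closure himg.symm).le

variable [Nonempty I] [TopologicalSpace I] [DiscreteTopology I]

theorem star_gen_mul_gen (j : I) : star (A.gen j) * A.gen j = A.diag (admInd A j) := by
  classical
  rw [isCKFamily_gen.star_mul_self]
  simp_rw [← wordProj_singleton, ← diag_cylInd, ← map_zsmul]
  rw [← map_sum]
  congr 1
  ext x
  simp only [ContinuousMap.sum_apply, ContinuousMap.smul_apply, cylInd_singleton_apply, smul_ite,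
    smul_zero, Finset.sum_ite_eq, Finset.mem_univ, if_true]
  rcases A.zero_or_one j (x.letter 0) with h | h
  · rw [admInd_of_not_adm (by rw [h]; decide), h, zero_smul]
  · rw [admInd_of_adm h, h, one_smul]

theorem gen_mul_diag_admInd (j : I) : A.gen j * A.diag (admInd A j) = A.gen j := by
  rw [← star_gen_mul_gen, ← mul_assoc, isCKFamily_gen.partial_isometry]

theorem gen_mul_diag_congr {j : I} {f g : C(A.Shift, ℂ)}
    (h : ∀ x : A.Shift, A.mat j (x.letter 0) = 1 → f x = g x) :
    A.gen j * A.diag f = A.gen j * A.diag g := by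
  rw [← gen_mul_diag_admInd j, mul_assoc, mul_assoc, ← map_mul, ← map_mul]
  congr 2
  ext x
  by_cases hx : A.mat j (x.letter 0) = 1
  · simp [h x hx]
  · simp [admInd_of_not_adm hx]

theorem continuous_diag : Continuous A.diag := map_continuous _

/-- The covariance relation between `C(Σ_A)` and the generators. -/
theorem diag_mul_gen (j : I) (f : C(A.Shift, ℂ)) :
    A.diag f * A.gen j = A.gen j * A.diag (branch j f) := by
  classical
  induction f using continuousMap_induction with
  | closed =>
    have hb : Continuous (branch j : C(A.Shift, ℂ) → C(A.Shift, ℂ)) :=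
      ContinuousMap.continuous_precomp _
    exact isClosed_eq (continuous_diag.mul continuous_const)
      (continuous_const.mul (continuous_diag.comp hb))
  | cyl w =>
    cases w with
    | nil =>
      rw [cylInd_nil]
      change _ = A.gen j * A.diag 1
      simp
    | cons k w =>
      rw [diag_cylInd, wordProj_cons, mul_assoc]
      by_cases hkj : k = j
      · subst hkj
        rw [star_gen_mul_gen, ← diag_cylInd, mul_assoc, ← map_mul]
        refine gen_mul_diag_congr fun x hx => ?_
        rw [ContinuousMap.mul_apply, admInd_of_adm hx, branch_apply, cylInd_cons_apply,
          letter_zero_prepend hx, if_pos rfl, shift_prepend hx, mul_one]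
      · rw [isCKFamily_gen.star_mul_of_ne hkj, mul_zero]
        rw [gen_mul_diag_congr (g := 0), map_zero, mul_zero]
        intro x hx
        rw [branch_apply, cylInd_cons_apply, letter_zero_prepend hx, if_neg (Ne.symm hkj)]
        rfl
  | const c =>
    have : branch j (algebraMap ℂ C(A.Shift, ℂ) c) = algebraMap ℂ C(A.Shift, ℂ) c := rfl
    rw [this, AlgHomClass.commutes, Algebra.commutes]
  | add f g hf hg =>
    have : branch j (f + g) = branch j f + branch j g := rfl
    rw [this, map_add, map_add, add_mul, mul_add, hf, hg]
  | mul f g hf hg =>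
    have : branch j (f * g) = branch j f * branch j g := rfl
    rw [this, map_mul, map_mul, mul_assoc, hg, ← mul_assoc, hf, mul_assoc]

theorem star_gen_mul_diag (j : I) (f : C(A.Shift, ℂ)) :
    star (A.gen j) * A.diag f = A.diag (branch j f) * star (A.gen j) := by
  have h := congrArg star (diag_mul_gen j (star f))
  rw [star_mul, star_mul, ← map_star, star_star, ← map_star] at h
  rw [h]
  congr 2
  ext x
  simp

theorem gen_mul_diag (j : I) (f : C(A.Shift, ℂ)) :
    A.gen j * A.diag f = A.diag (compShift f) * A.gen j := by
  rw [diag_mul_gen]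
  refine gen_mul_diag_congr fun x hx => ?_
  rw [branch_apply, compShift_apply, shift_prepend hx]

theorem star_gen_mul_diag_mul_gen (j : I) (f : C(A.Shift, ℂ)) :
    star (A.gen j) * A.diag f * A.gen j = A.diag (admInd A j * branch j f) := by
  rw [mul_assoc, diag_mul_gen, ← mul_assoc, star_gen_mul_gen, map_mul]

theorem diag_perronFrobenius (H : C(A.Shift, ℝ)) (β : ℝ) (f : C(A.Shift, ℂ)) :
    A.diag (perronFrobenius (-(β • H)) f) =
      ∑ j, star (A.gen j) * A.diag (cphase H (β * Complex.I) * f) * A.gen j := by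
  rw [perronFrobenius_eq_sum, map_sum]
  simp_rw [star_gen_mul_diag_mul_gen]

theorem gaugeAction_diag (H : C(A.Shift, ℝ)) (t : ℝ) (f : C(A.Shift, ℂ)) :
    gaugeAction H t (A.diag f) = A.diag f := by
  let φ : A.CKAlgebra →⋆ₐ[ℂ] A.CKAlgebra := (gaugeAction H t : A.CKAlgebra →⋆ₐ[ℂ] A.CKAlgebra)
  have h : φ.comp A.diag = A.diag := diag_unique fun w => by
    change gaugeAction H t (A.diag _) = _
    rw [diag_cylInd]
    induction w with
    | nil => simp [wordProj, wordProd]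
    | cons i w ih =>
      rw [wordProj_cons, map_mul, map_mul, map_star, gaugeAction_gen, ih, star_mul, ← mul_assoc,
        mul_assoc _ (A.gen i), mul_assoc _ (A.gen i * _), ← wordProj_cons, phase_conj]
  exact DFunLike.congr_fun h f

theorem norm_gaugeAction (H : C(A.Shift, ℝ)) (t : ℝ) (X : A.CKAlgebra) :
    ‖gaugeAction H t X‖ = ‖X‖ :=
  NonUnitalStarAlgHom.norm_map (gaugeAction H t) (gaugeAction H t).injective X

end TransitionMatrix

namespace TransitionMatrix

open Shift
open scoped CStarAlgebra ComplexOrder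

/-! ### Positive functionals -/

section Positive

variable {B : Type*} [CStarAlgebra B] {σ : B →L[ℂ] ℂ}

theorem exists_positiveLinearMap_of_nonneg [PartialOrder B] [StarOrderedRing B]
    (hσ : ∀ X, 0 ≤ σ (star X * X)) : ∃ f : B →ₚ[ℂ] ℂ, ∀ X, f X = σ X := by
  refine ⟨PositiveLinearMap.mk₀ (σ : B →ₗ[ℂ] ℂ) fun X hX => ?_, fun X => rfl⟩
  obtain ⟨Y, rfl⟩ := CStarAlgebra.nonneg_iff_eq_star_mul_self.1 hX
  exact hσ Y

theorem map_star_of_nonneg (hσ : ∀ X, 0 ≤ σ (star X * X)) (X : B) : σ (star X) = star (σ X) := by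
  let _ := CStarAlgebra.spectralOrder B
  have := CStarAlgebra.spectralOrderedRing B
  obtain ⟨f, hf⟩ := exists_positiveLinearMap_of_nonneg hσ
  rw [← hf, ← hf]
  exact map_star f X

theorem norm_map_star_mul_sq_le (hσ : ∀ X, 0 ≤ σ (star X * X)) (X Y : B) :
    ‖σ (star X * Y)‖ ^ 2 ≤ (σ (star X * X)).re * (σ (star Y * Y)).re := by
  let _ := CStarAlgebra.spectralOrder B
  have := CStarAlgebra.spectralOrderedRing B
  obtain ⟨f, hf⟩ := exists_positiveLinearMap_of_nonneg hσ
  have h := norm_inner_le_norm (𝕜 := ℂ) (f.toPreGNS X) (f.toPreGNS Y)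
  rw [PositiveLinearMap.preGNS_inner_def] at h
  have h2 : ∀ Z, ‖f.toPreGNS Z‖ ^ 2 = (σ (star Z * Z)).re := fun Z => by
    have := congrArg Complex.re (f.preGNS_norm_sq (f.toPreGNS Z))
    rw [← Complex.ofReal_pow, Complex.ofReal_re] at this
    rw [this, ← hf]
    rfl
  rw [← h2, ← h2, ← hf, ← mul_pow]
  exact pow_le_pow_left₀ (norm_nonneg _) h 2

theorem map_one_of_norm_eq_one (hσ : ∀ X, 0 ≤ σ (star X * X)) (h1 : ‖σ‖ = 1) : σ 1 = 1 := by
  let _ := CStarAlgebra.spectralOrder B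
  have := CStarAlgebra.spectralOrderedRing B
  have hpos : 0 ≤ σ 1 := by simpa using hσ 1
  have hre : σ 1 = ((σ 1).re : ℂ) :=
    Complex.ext (by simp) (by simpa using (Complex.nonneg_iff.1 hpos).2.symm)
  have h0 : 0 ≤ (σ 1).re := (Complex.nonneg_iff.1 hpos).1
  have hb : ∀ X, ‖σ X‖ ≤ (σ 1).re * ‖X‖ := fun X => by
    have hcs := norm_map_star_mul_sq_le hσ 1 X
    rw [star_one, one_mul, one_mul] at hcs
    have hle : (σ (star X * X)).re ≤ (σ 1).re * ‖X‖ ^ 2 := by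
      obtain ⟨Y, hY⟩ := CStarAlgebra.nonneg_iff_eq_star_mul_self.1
        (sub_nonneg.2 (CStarAlgebra.star_mul_le_algebraMap_norm_sq (a := X)))
      have h := (Complex.nonneg_iff.1 (hσ Y)).1
      have e : (algebraMap ℝ B (‖X‖ ^ 2)) = ((‖X‖ ^ 2 : ℝ) : ℂ) • (1 : B) := by
        rw [Algebra.algebraMap_eq_smul_one, Complex.coe_smul]
      rw [← hY, map_sub, e, map_smul, hre, smul_eq_mul, ← Complex.ofReal_mul, Complex.sub_re,
        Complex.ofReal_re] at h
      linarith
    refine abs_le_of_sq_le_sq' ?_ (by positivity) |>.2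
    nlinarith
  have hle : 1 ≤ (σ 1).re := h1 ▸ σ.opNorm_le_bound h0 hb
  have hge : (σ 1).re ≤ 1 := by
    rcases subsingleton_or_nontrivial B with hB | hB
    · have : σ = 0 := by ext X; rw [Subsingleton.elim X 0]; simp
      rw [this, norm_zero] at h1
      exact absurd h1 zero_ne_one
    · calc (σ 1).re ≤ ‖σ 1‖ := Complex.re_le_norm _
        _ ≤ ‖σ‖ * ‖(1 : B)‖ := σ.le_opNorm 1
        _ = 1 := by rw [h1, CStarRing.norm_one, one_mul]
  rw [hre, le_antisymm hge hle, Complex.ofReal_one]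

end Positive

variable {I : Type u} [Fintype I] [Nonempty I] [TopologicalSpace I] [DiscreteTopology I]
  {A : TransitionMatrix I} {σ : A.CKAlgebra →L[ℂ] ℂ}

theorem IsState.map_one (hσ : IsState σ) : σ 1 = 1 :=
  map_one_of_norm_eq_one hσ.nonneg hσ.norm_eq_one

/-- By the Riesz representation theorem the restriction of a state to `C(Σ_A)` is integration with
respect to a probability measure. -/
theorem IsState.exists_restrictsTo (hσ : IsState σ) :
    ∃ μ : ProbabilityMeasure A.Shift, RestrictsTo σ μ := by
  have hpos : ∀ f : C(A.Shift, ℝ), 0 ≤ f → 0 ≤ σ (A.diag (toComplex f)) := fun f hf => by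
    let g : C(A.Shift, ℂ) := toComplex ⟨fun x => Real.sqrt (f x), by fun_prop⟩
    have : toComplex f = star g * g := by
      ext x
      have h0 : 0 ≤ f x := hf x
      simp only [g, toComplex_apply, ContinuousMap.mul_apply, ContinuousMap.star_apply,
        ContinuousMap.coe_mk, Complex.star_def, Complex.conj_ofReal, ← Complex.ofReal_mul,
        Real.mul_self_sqrt h0]
    rw [this, map_mul, map_star]
    exact hσ.nonneg _
  have him : ∀ f : C(A.Shift, ℝ),
      ((σ (A.diag (toComplex f))).re : ℂ) = σ (A.diag (toComplex f)) := fun f => by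
    have hstar : star (toComplex f) = toComplex f := by ext x; simp
    rw [← Complex.conj_eq_iff_re, ← Complex.star_def, ← map_star_of_nonneg hσ.nonneg, ← map_star,
      hstar]
  let Λ : CompactlySupportedContinuousMap A.Shift ℝ →ₚ[ℝ] ℝ := PositiveLinearMap.mk₀
    { toFun := fun f => (σ (A.diag (toComplex f.toContinuousMap))).re
      map_add' := fun f g => by
        have : toComplex (f + g).toContinuousMap =
            toComplex f.toContinuousMap + toComplex g.toContinuousMap := by ext x; simp
        rw [this, _root_.map_add, _root_.map_add, Complex.add_re]
      map_smul' := fun c f => by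
        have : toComplex (c • f).toContinuousMap = (c : ℂ) • toComplex f.toContinuousMap := by
          ext x; simp
        rw [this, _root_.map_smul, _root_.map_smul, smul_eq_mul, Complex.re_ofReal_mul]
        rfl }
    fun f hf => (Complex.nonneg_iff.1 (hpos _ hf)).1
  have hΛ : ∀ f : C(A.Shift, ℝ), ∫ x, f x ∂(RealRMK.rieszMeasure Λ) =
      (σ (A.diag (toComplex f))).re := fun f =>
    RealRMK.integral_rieszMeasure Λ ⟨f, HasCompactSupport.of_compactSpace f⟩
  have hfin : IsFiniteMeasure (RealRMK.rieszMeasure Λ) := inferInstance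
  have hprob : IsProbabilityMeasure (RealRMK.rieszMeasure Λ) := by
    have h := hΛ 1
    have h1 : toComplex (1 : C(A.Shift, ℝ)) = 1 := by ext x; simp
    rw [h1, _root_.map_one, hσ.map_one] at h
    simp only [ContinuousMap.one_apply, integral_const, smul_eq_mul, mul_one, Complex.one_re] at h
    refine ⟨?_⟩
    rw [measureReal_def] at h
    rw [← ENNReal.ofReal_toReal (measure_ne_top (RealRMK.rieszMeasure Λ) univ), h,
      ENNReal.ofReal_one]
  refine ⟨⟨RealRMK.rieszMeasure Λ, hprob⟩, fun f => ?_⟩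
  let fr : C(A.Shift, ℝ) := ⟨fun x => (f x).re, by fun_prop⟩
  let fi : C(A.Shift, ℝ) := ⟨fun x => (f x).im, by fun_prop⟩
  have hf : f = toComplex fr + Complex.I • toComplex fi := by
    ext x
    change f x = ((f x).re : ℂ) + Complex.I * ((f x).im : ℂ)
    rw [mul_comm, Complex.re_add_im]
  change _ = ∫ x, f x ∂(RealRMK.rieszMeasure Λ)
  rw [hf, _root_.map_add, _root_.map_add, _root_.map_smul, _root_.map_smul, ← him fr, ← him fi,
    ← hΛ, ← hΛ, ← integral_complex_ofReal, ← integral_complex_ofReal, smul_eq_mul,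
    ← integral_const_mul]
  exact (integral_add (integrable_continuousMap _ (toComplex fr))
    ((integrable_continuousMap _ (toComplex fi)).const_mul _)).symm

theorem RestrictsTo.unique {μ ν : ProbabilityMeasure A.Shift} (hμ : RestrictsTo σ μ)
    (hν : RestrictsTo σ ν) : μ = ν := by
  have := μ.2
  have := ν.2
  exact Subtype.ext (measure_ext fun f => (hμ f).symm.trans (hν f))

end TransitionMatrix

/-! ### Boundary values on a strip -/

namespace Complex.HadamardThreeLines

theorem norm_le_of_boundary_le {f : ℂ → ℂ} {C : ℝ} (hC : 0 < C)
    (hd : DiffContOnCl ℂ f (verticalStrip 0 1))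
    (hb : BddAbove ((norm ∘ f) '' verticalClosedStrip 0 1))
    (h0 : ∀ t : ℝ, ‖f (t * Complex.I)‖ ≤ C) (h1 : ∀ t : ℝ, ‖f (1 + t * Complex.I)‖ ≤ C)
    {z : ℂ} (hz : z ∈ verticalClosedStrip 0 1) : ‖f z‖ ≤ C := by
  have h := norm_le_interp_of_mem_verticalClosedStrip' zero_lt_one hz hd hb (a := C) (b := C)
    (fun w hw => by
      have : w = w.im * Complex.I := Complex.ext (by simpa using hw) (by simp)
      rw [this]; exact h0 _)
    (fun w hw => by
      have : w = 1 + w.im * Complex.I := Complex.ext (by simpa using hw) (by simp)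
      rw [this]; exact h1 _)
  rwa [← Real.rpow_add hC, sub_add_cancel, Real.rpow_one] at h

/-- If bounded analytic functions on a strip converge to zero uniformly on one boundary line, and
converge uniformly on the other boundary line to a bounded function, then the latter vanishes:
by the three lines theorem the functions form a uniform Cauchy sequence on the closed strip, and
they converge to zero in its interior. -/
theorem boundary_limit_eq_zero {F : ℕ → ℂ → ℂ} {a b : ℕ → ℝ} {c : ℝ → ℂ} {M : ℝ}
    (hd : ∀ n, DiffContOnCl ℂ (F n) (verticalStrip 0 1))
    (hbd : ∀ n, BddAbove ((norm ∘ F n) '' verticalClosedStrip 0 1))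
    (ha : Tendsto a atTop (𝓝 0)) (hb : Tendsto b atTop (𝓝 0)) (hc : ∀ t, ‖c t‖ ≤ M)
    (h0 : ∀ n (t : ℝ), ‖F n (t * Complex.I)‖ ≤ a n)
    (h1 : ∀ n (t : ℝ), ‖F n (1 + t * Complex.I) - c t‖ ≤ b n) : c 0 = 0 := by
  have ha0 : ∀ n, 0 ≤ a n := fun n => (norm_nonneg _).trans (h0 n 0)
  have hM : 0 ≤ M := (norm_nonneg _).trans (hc 0)
  -- in the interior of the strip the functions converge to zero
  have hint : ∀ s ∈ Ioo (0 : ℝ) 1, Tendsto (fun n => F n s) atTop (𝓝 0) := by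
    intro s hs
    have hlim : Tendsto (fun n => a n ^ (1 - s) * (M + 1) ^ s) atTop (𝓝 0) := by
      have := (ha.rpow_const (p := 1 - s) (Or.inr (by linarith [hs.2]))).mul_const ((M + 1) ^ s)
      rwa [Real.zero_rpow (by linarith [hs.2]), zero_mul] at this
    refine squeeze_zero_norm' ?_ hlim
    filter_upwards [hb.eventually_le_const zero_lt_one] with n hn
    have hsz : (s : ℂ) ∈ verticalClosedStrip 0 1 := by
      change (s : ℂ).re ∈ Icc (0 : ℝ) 1
      exact ⟨hs.1.le, hs.2.le⟩
    have := norm_le_interp_of_mem_verticalClosedStrip' zero_lt_one hsz (hd n) (hbd n)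
      (a := a n) (b := M + 1)
      (fun w hw => by
        have : w = w.im * Complex.I := Complex.ext (by simpa using hw) (by simp)
        rw [this]; exact h0 _ _)
      (fun w hw => by
        have : w = 1 + w.im * Complex.I := Complex.ext (by simpa using hw) (by simp)
        rw [this]
        calc ‖F n (1 + w.im * Complex.I)‖
            ≤ ‖F n (1 + w.im * Complex.I) - c w.im‖ + ‖c w.im‖ := norm_le_norm_sub_add _ _
          _ ≤ M + 1 := by linarith [h1 n w.im, hc w.im])
    simpa using this
  refine norm_le_zero_iff.1 (le_of_forall_pos_le_add fun ε hε => ?_)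
  obtain ⟨N, hN⟩ := eventually_atTop.1 ((ha.eventually_le_const (u := ε / 3) (by positivity)).and
    (hb.eventually_le_const (u := ε / 3) (by positivity)))
  -- the functions form a uniform Cauchy sequence
  have hcauchy : ∀ m ≥ N, ∀ z ∈ verticalClosedStrip 0 1, ‖F N z - F m z‖ ≤ 2 * ε / 3 := by
    intro m hm z hz
    refine norm_le_of_boundary_le (f := fun z => F N z - F m z) (by positivity)
      ((hd N).sub (hd m)) ?_ (fun t => ?_) (fun t => ?_) hz
    · obtain ⟨C, hC⟩ := hbd N
      obtain ⟨C', hC'⟩ := hbd m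
      refine ⟨C + C', ?_⟩
      rintro _ ⟨w, hw, rfl⟩
      exact (norm_sub_le _ _).trans
        (add_le_add (hC (mem_image_of_mem _ hw)) (hC' (mem_image_of_mem _ hw)))
    · calc _ ≤ ‖F N (t * Complex.I)‖ + ‖F m (t * Complex.I)‖ := norm_sub_le _ _
        _ ≤ 2 * ε / 3 := by linarith [h0 N t, h0 m t, (hN N le_rfl).1, (hN m hm).1]
    · calc ‖F N (1 + t * Complex.I) - F m (1 + t * Complex.I)‖
          = ‖(F N (1 + t * Complex.I) - c t) - (F m (1 + t * Complex.I) - c t)‖ := by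
            rw [sub_sub_sub_cancel_right]
        _ ≤ ‖F N (1 + t * Complex.I) - c t‖ + ‖F m (1 + t * Complex.I) - c t‖ := norm_sub_le _ _
        _ ≤ 2 * ε / 3 := by linarith [h1 N t, h1 m t, (hN N le_rfl).2, (hN m hm).2]
  have hFN : ∀ s ∈ Ioo (0 : ℝ) 1, ‖F N s‖ ≤ 2 * ε / 3 := by
    intro s hs
    have hl := ((tendsto_const_nhds (x := F N s)).sub (hint s hs)).norm
    rw [sub_zero] at hl
    refine le_of_tendsto hl ?_
    filter_upwards [eventually_ge_atTop N] with m hm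
    exact hcauchy m hm s ⟨hs.1.le, hs.2.le⟩
  have hclos : ∀ s : ℝ, s ∈ Ioc (0 : ℝ) 1 → (s : ℂ) ∈ closure (verticalStrip 0 1) := by
    intro s hs
    have : closure (Ioo (0 : ℝ) 1) = Icc 0 1 := closure_Ioo zero_ne_one
    have hmem : s ∈ closure (Ioo (0 : ℝ) 1) := this ▸ ⟨hs.1.le, hs.2⟩
    exact map_mem_closure Complex.continuous_ofReal hmem fun r hr => hr
  have hF1 : ‖F N 1‖ ≤ 2 * ε / 3 := by
    have hcont : ContinuousOn (fun s : ℝ => ‖F N s‖) (Ioc 0 1) :=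
      ((hd N).continuousOn.comp Complex.continuous_ofReal.continuousOn hclos).norm
    have ht : Tendsto (fun s : ℝ => ‖F N s‖) (𝓝[Ioo 0 1] 1) (𝓝 ‖F N (1 : ℝ)‖) :=
      (hcont 1 ⟨zero_lt_one, le_rfl⟩).mono_left (nhdsWithin_mono _ Ioo_subset_Ioc_self)
    have hne : (𝓝[Ioo (0 : ℝ) 1] 1).NeBot := right_nhdsWithin_Ioo_neBot zero_lt_one
    rw [Complex.ofReal_one] at ht
    refine le_of_tendsto ht ?_
    filter_upwards [self_mem_nhdsWithin] with s hs using hFN s hs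
  have h10 := h1 N 0
  rw [Complex.ofReal_zero, zero_mul, add_zero] at h10
  calc ‖c 0‖ = ‖F N 1 - (F N 1 - c 0)‖ := by rw [sub_sub_cancel]
    _ ≤ ‖F N 1‖ + ‖F N 1 - c 0‖ := norm_sub_le _ _
    _ ≤ 0 + ε := by linarith [(hN N le_rfl).2]

end Complex.HadamardThreeLines

namespace TransitionMatrix

open Shift
open scoped CStarAlgebra ComplexOrder

variable {I : Type u} [Fintype I] [Nonempty I] [TopologicalSpace I] [DiscreteTopology I]
  {A : TransitionMatrix I} {σ : A.CKAlgebra →L[ℂ] ℂ} {H : C(A.Shift, ℝ)} {β : ℝ}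

/-! ### The algebraic form of the KMS condition -/

/-- The KMS condition on generators, without analytic functions: `C(Σ_A)` lies in the centralizer
of `σ`, and `σ(S_j X) = σ(X α_H^{iβ}(S_j))` with `α_H^{iβ}(S_j) = e^{-βH} S_j`. -/
structure IsModular (H : C(A.Shift, ℝ)) (β : ℝ) (σ : A.CKAlgebra →L[ℂ] ℂ) : Prop where
  diag_comm : ∀ (f : C(A.Shift, ℂ)) (X : A.CKAlgebra), σ (A.diag f * X) = σ (X * A.diag f)
  gen_mul : ∀ (j : I) (X : A.CKAlgebra),
    σ (A.gen j * X) = σ (X * (A.diag (cphase H (β * Complex.I)) * A.gen j))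

theorem norm_map_mul_sub_le (σ : A.CKAlgebra →L[ℂ] ℂ) (X Y X' Y' : A.CKAlgebra) :
    ‖σ (X * Y) - σ (X' * Y')‖ ≤ ‖σ‖ * (‖X‖ * ‖Y - Y'‖ + ‖X - X'‖ * ‖Y'‖) := by
  have : X * Y - X' * Y' = X * (Y - Y') + (X - X') * Y' := by
    rw [mul_sub, sub_mul, sub_add_sub_cancel]
  rw [← map_sub, this]
  refine (σ.le_opNorm _).trans (mul_le_mul_of_nonneg_left ?_ (norm_nonneg _))
  exact (norm_add_le _ _).trans (add_le_add (norm_mul_le _ _) (norm_mul_le _ _))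

theorem norm_map_mul_le (σ : A.CKAlgebra →L[ℂ] ℂ) (X Y : A.CKAlgebra) :
    ‖σ (X * Y)‖ ≤ ‖σ‖ * (‖X‖ * ‖Y‖) :=
  (σ.le_opNorm _).trans (mul_le_mul_of_nonneg_left (norm_mul_le _ _) (norm_nonneg _))

/-- For an element `Y` whose orbit under the dynamics extends to an entire function `y` that is
bounded on the strip, the KMS condition gives `σ(Y X) = σ(X y(iβ))` for all `X`, whatever the dense
set in the definition is. -/
theorem IsKMSState.map_mul_of_entire (hσ : IsKMSState H β σ) (hβ : β ≠ 0) {Y : A.CKAlgebra}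
    {y : ℂ → A.CKAlgebra} (hy : Differentiable ℂ y) {C : ℝ}
    (hC : ∀ z : ℂ, z.im ∈ uIcc 0 β → ‖y z‖ ≤ C) (hα : ∀ t : ℝ, y t = gaugeAction H t Y)
    (X : A.CKAlgebra) : σ (gaugeAction H 0 Y * X) = σ (X * y (β * Complex.I)) := by
  obtain ⟨D, hD, hF⟩ := hσ.exists_dense
  obtain ⟨Xs, hXs, hXl⟩ := mem_closure_iff_seq_limit.1 (hD X)
  obtain ⟨Ys, hYs, hYl⟩ := mem_closure_iff_seq_limit.1 (hD Y)
  choose F hFc hFd hFb hFv using fun n => hF (Xs n) (hXs n) (Ys n) (hYs n)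
  -- the map `w ↦ iβw` takes the strip `0 ≤ Re w ≤ 1` to the strip between `Im z = 0` and `Im z = β`
  let e : ℂ → ℂ := fun w => β * Complex.I * w
  have he : Differentiable ℂ e := by fun_prop
  have him : ∀ w, (e w).im = β * w.re := fun w => by simp [e]
  have hclosed : MapsTo e (Complex.re ⁻¹' Icc 0 1) {z | z.im ∈ uIcc 0 β} := by
    intro w hw
    obtain ⟨h0, h1⟩ : 0 ≤ w.re ∧ w.re ≤ 1 := hw
    change (e w).im ∈ uIcc 0 β
    rw [him, mem_uIcc]
    rcases le_total 0 β with h | h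
    · left; constructor <;> nlinarith
    · right; constructor <;> nlinarith
  have hopen : MapsTo e (Complex.re ⁻¹' Ioo 0 1) {z | z.im ∈ uIoo 0 β} := by
    intro w hw
    obtain ⟨h0, h1⟩ : 0 < w.re ∧ w.re < 1 := hw
    change (e w).im ∈ uIoo 0 β
    rw [him]
    rcases lt_or_gt_of_ne hβ with h | h
    · rw [uIoo_of_ge h.le]; constructor <;> nlinarith
    · rw [uIoo_of_le h.le]; constructor <;> nlinarith
  have hG : Differentiable ℂ fun z => σ (X * y z) :=
    σ.differentiable.comp ((differentiable_const X).mul hy)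
  have hcl : closure (Complex.HadamardThreeLines.verticalStrip 0 1) ⊆ Complex.re ⁻¹' Icc 0 1 :=
    closure_minimal (preimage_mono Ioo_subset_Icc_self)
      (isClosed_Icc.preimage Complex.continuous_re)
  have hiso : ∀ t Z, ‖gaugeAction H t Z‖ = ‖Z‖ := norm_gaugeAction H
  have he0 : ∀ t : ℝ, e (t * Complex.I) = ((-(β * t) : ℝ) : ℂ) := fun t => by
    simp only [e]
    push_cast
    linear_combination (β * t : ℂ) * Complex.I_mul_I
  have he1 : ∀ t : ℝ, e (1 + t * Complex.I) = ((-(β * t) : ℝ) : ℂ) + β * Complex.I := fun t => by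
    simp only [e]
    push_cast
    linear_combination (β * t : ℂ) * Complex.I_mul_I
  have hXn := hXl.norm
  have hXd : Tendsto (fun n => ‖Xs n - X‖) atTop (𝓝 0) :=
    tendsto_iff_norm_sub_tendsto_zero.1 hXl
  have hYn := hYl.norm
  have hYd : Tendsto (fun n => ‖Ys n - Y‖) atTop (𝓝 0) :=
    tendsto_iff_norm_sub_tendsto_zero.1 hYl
  have key := Complex.HadamardThreeLines.boundary_limit_eq_zero
    (F := fun n w => F n (e w) - σ (X * y (e w)))
    (a := fun n => ‖σ‖ * (‖Xs n‖ * ‖Ys n - Y‖ + ‖Xs n - X‖ * ‖Y‖))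
    (b := fun n => ‖σ‖ * (‖Ys n‖ * ‖Xs n - X‖ + ‖Ys n - Y‖ * ‖X‖))
    (c := fun t => σ (gaugeAction H (-(β * t)) Y * X) -
      σ (X * y (((-(β * t) : ℝ) : ℂ) + β * Complex.I)))
    (M := ‖σ‖ * (‖Y‖ * ‖X‖) + ‖σ‖ * (‖X‖ * C))
    (fun n => ?_) (fun n => ?_) ?_ ?_ (fun t => ?_) (fun n t => ?_) (fun n t => ?_)
  · simpa [sub_eq_zero] using key
  · refine DiffContOnCl.sub ⟨?_, ?_⟩ (hG.comp he).diffContOnCl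
    · exact (hFd n).comp he.differentiableOn hopen
    · exact (hFc n).comp he.continuous.continuousOn fun w hw => hclosed (hcl hw)
  · obtain ⟨K, hK⟩ := hFb n
    refine ⟨K + ‖σ‖ * (‖X‖ * C), ?_⟩
    rintro _ ⟨w, hw, rfl⟩
    refine (norm_sub_le _ _).trans (add_le_add (hK _ (hclosed hw)) ?_)
    exact (norm_map_mul_le _ _ _).trans (by gcongr; exact hC _ (hclosed hw))
  · have := ((hXn.mul hYd).add (hXd.mul_const ‖Y‖)).const_mul ‖σ‖
    simpa using this
  · have := ((hYn.mul hXd).add (hYd.mul_const ‖X‖)).const_mul ‖σ‖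
    simpa using this
  · refine (norm_sub_le _ _).trans (add_le_add ?_ ?_)
    · rw [← hiso (-(β * t)) Y]
      exact norm_map_mul_le _ _ _
    · refine (norm_map_mul_le _ _ _).trans ?_
      gcongr
      refine hC _ ?_
      simp
  · rw [he0, (hFv n _).1, hα, ← hiso (-(β * t)) Y, ← hiso (-(β * t)) (Ys n - Y), map_sub]
    exact norm_map_mul_sub_le _ _ _ _ _
  · rw [he1, (hFv n _).2, sub_sub_sub_cancel_right, ← hiso (-(β * t)) (Ys n),
      ← hiso (-(β * t)) (Ys n - Y), map_sub]
    exact norm_map_mul_sub_le _ _ _ _ _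

theorem norm_diag_le (f : C(A.Shift, ℂ)) : ‖A.diag f‖ ≤ ‖f‖ :=
  NonUnitalStarAlgHom.norm_apply_le _ _

theorem differentiable_diag_cphase (H : C(A.Shift, ℝ)) :
    Differentiable ℂ fun z => A.diag (cphase H z) := by
  let L : C(A.Shift, ℂ) →L[ℂ] A.CKAlgebra := ⟨A.diag.toAlgHom.toLinearMap, continuous_diag⟩
  exact L.differentiable.comp (differentiable_cphase H)

theorem gaugeAction_zero_gen (H : C(A.Shift, ℝ)) (j : I) :
    gaugeAction H 0 (A.gen j) = A.gen j := by
  rw [gaugeAction_gen, phase_zero, map_one, one_mul]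

theorem IsKMSState.isModular (hσ : IsKMSState H β σ) (hβ : β ≠ 0) : IsModular H β σ where
  diag_comm f X := by
    have := hσ.map_mul_of_entire hβ (Y := A.diag f) (differentiable_const (A.diag f))
      (fun z _ => le_rfl) (fun t => (gaugeAction_diag H t f).symm) X
    rwa [gaugeAction_diag] at this
  gen_mul j X := by
    have := hσ.map_mul_of_entire hβ (Y := A.gen j) (y := fun z => A.diag (cphase H z) * A.gen j)
      ((differentiable_diag_cphase H).mul (differentiable_const _))
      (C := Real.exp (|β| * ‖H‖) * ‖A.gen j‖) (fun z hz => ?_)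
      (fun t => (gaugeAction_gen H t j).symm) X
    · rwa [gaugeAction_zero_gen] at this
    · refine (norm_mul_le _ _).trans ?_
      gcongr
      refine (norm_diag_le _).trans ((norm_cphase_le H z).trans ?_)
      refine Real.exp_le_exp.2 (mul_le_mul_of_nonneg_right ?_ (norm_nonneg _))
      have := abs_sub_left_of_mem_uIcc hz
      simpa using this

theorem IsModular.star_gen_mul (hσ : IsModular H β σ) (hs : IsState σ) (j : I) (X : A.CKAlgebra) :
    σ (star (A.gen j) * X) = σ (X * (star (A.gen j) * A.diag (cphase H (-(β * Complex.I))))) := by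
  have h := congrArg star
    (hσ.gen_mul j (star X * A.diag (star (cphase H (-(β * Complex.I))))))
  rw [← map_star_of_nonneg hs.nonneg, ← map_star_of_nonneg hs.nonneg] at h
  simp only [star_mul, star_star, ← map_star, star_cphase_mul_I] at h
  rw [mul_assoc, hσ.diag_comm, mul_assoc (star (A.gen j)), ← mul_assoc (A.diag _), ← map_mul,
    ← cphase_add, add_neg_cancel, cphase_zero, map_one, one_mul, mul_assoc] at h
  exact h.symm

/-- The orbit of `Y` extends to an entire function that is bounded on horizontal strips and
satisfies the KMS identity for `σ`. The elements with this property form an algebra, so the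
identity propagates from the generators. -/
def HasEntireOrbit (H : C(A.Shift, ℝ)) (β : ℝ) (σ : A.CKAlgebra →L[ℂ] ℂ) (Y : A.CKAlgebra) :
    Prop :=
  ∃ y : ℂ → A.CKAlgebra, Differentiable ℂ y ∧
    (∀ M : ℝ, ∃ C : ℝ, ∀ z : ℂ, |z.im| ≤ M → ‖y z‖ ≤ C) ∧
    (∀ t : ℝ, y t = gaugeAction H t Y) ∧
    ∀ z X, σ (y z * X) = σ (X * y (z + β * Complex.I))

theorem HasEntireOrbit.const (c : ℂ) :
    HasEntireOrbit H β σ (algebraMap ℂ A.CKAlgebra c) := by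
  refine ⟨fun _ => algebraMap ℂ A.CKAlgebra c, differentiable_const _,
    fun M => ⟨_, fun z _ => le_rfl⟩, fun t => ?_, fun z X => ?_⟩
  · exact (AlgHomClass.commutes (gaugeAction H t) c).symm
  · rw [Algebra.commutes]

theorem HasEntireOrbit.add {Y Z : A.CKAlgebra} (hY : HasEntireOrbit H β σ Y)
    (hZ : HasEntireOrbit H β σ Z) : HasEntireOrbit H β σ (Y + Z) := by
  obtain ⟨y, hyd, hyb, hyα, hy⟩ := hY
  obtain ⟨x, hxd, hxb, hxα, hx⟩ := hZ
  refine ⟨fun z => y z + x z, hyd.add hxd, fun M => ?_, fun t => ?_, fun z X => ?_⟩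
  · obtain ⟨C, hC⟩ := hyb M
    obtain ⟨K, hK⟩ := hxb M
    exact ⟨C + K, fun z hz => (norm_add_le _ _).trans (add_le_add (hC z hz) (hK z hz))⟩
  · beta_reduce
    rw [hyα, hxα, map_add]
  · beta_reduce
    rw [add_mul, mul_add, map_add, map_add, hy, hx]

theorem HasEntireOrbit.mul {Y Z : A.CKAlgebra} (hY : HasEntireOrbit H β σ Y)
    (hZ : HasEntireOrbit H β σ Z) : HasEntireOrbit H β σ (Y * Z) := by
  obtain ⟨y, hyd, hyb, hyα, hy⟩ := hY
  obtain ⟨x, hxd, hxb, hxα, hx⟩ := hZ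
  refine ⟨fun z => y z * x z, hyd.mul hxd, fun M => ?_, fun t => ?_, fun z X => ?_⟩
  · obtain ⟨C, hC⟩ := hyb M
    obtain ⟨K, hK⟩ := hxb M
    refine ⟨C * K, fun z hz => (norm_mul_le _ _).trans ?_⟩
    exact mul_le_mul (hC z hz) (hK z hz) (norm_nonneg _) ((norm_nonneg _).trans (hC z hz))
  · beta_reduce
    rw [hyα, hxα, map_mul]
  · beta_reduce
    rw [mul_assoc, hy, mul_assoc, hx, mul_assoc]

theorem IsModular.hasEntireOrbit_gen (hσ : IsModular H β σ) (j : I) :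
    HasEntireOrbit H β σ (A.gen j) := by
  refine ⟨fun z => A.diag (cphase H z) * A.gen j,
    (differentiable_diag_cphase H).mul (differentiable_const _), fun M => ?_, fun t => ?_,
    fun z X => ?_⟩
  · refine ⟨Real.exp (M * ‖H‖) * ‖A.gen j‖, fun z hz => (norm_mul_le _ _).trans ?_⟩
    gcongr
    exact (norm_diag_le _).trans ((norm_cphase_le H z).trans (by gcongr))
  · exact (gaugeAction_gen H t j).symm
  · beta_reduce
    rw [mul_assoc, hσ.diag_comm, mul_assoc, hσ.gen_mul, cphase_add, map_mul A.diag]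
    simp only [mul_assoc]

theorem IsModular.hasEntireOrbit_star_gen (hσ : IsModular H β σ) (hs : IsState σ) (j : I) :
    HasEntireOrbit H β σ (star (A.gen j)) := by
  refine ⟨fun z => star (A.gen j) * A.diag (cphase H (-z)),
    (differentiable_const _).mul ((differentiable_diag_cphase H).comp differentiable_neg),
    fun M => ?_, fun t => ?_, fun z X => ?_⟩
  · refine ⟨‖star (A.gen j)‖ * Real.exp (M * ‖H‖), fun z hz => (norm_mul_le _ _).trans ?_⟩
    gcongr
    refine (norm_diag_le _).trans ((norm_cphase_le H _).trans ?_)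
    rw [Complex.neg_im, abs_neg]
    gcongr
  · rw [map_star, gaugeAction_gen, star_mul, ← map_star, star_phase, ← cphase_ofReal,
      Complex.ofReal_neg]
  · beta_reduce
    rw [mul_assoc, hσ.star_gen_mul hs, mul_assoc, hσ.diag_comm, neg_add, add_comm (-z), cphase_add,
      map_mul A.diag]
    simp only [mul_assoc]

theorem IsModular.isKMSState (hσ : IsModular H β σ) (hs : IsState σ) : IsKMSState H β σ := by
  have hgood : ∀ Y ∈ StarAlgebra.adjoin ℂ (range A.gen),
      HasEntireOrbit H β σ Y ∧ HasEntireOrbit H β σ (star Y) := by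
    intro Y hY
    induction hY using StarAlgebra.adjoin_induction with
    | mem Y hY =>
      obtain ⟨j, rfl⟩ := hY
      exact ⟨hσ.hasEntireOrbit_gen j, hσ.hasEntireOrbit_star_gen hs j⟩
    | algebraMap c =>
      rw [← algebraMap_star_comm]
      exact ⟨.const _, .const _⟩
    | add f g _ _ hf hg =>
      rw [star_add]
      exact ⟨hf.1.add hg.1, hf.2.add hg.2⟩
    | mul f g _ _ hf hg =>
      rw [star_mul]
      exact ⟨hf.1.mul hg.1, hg.2.mul hf.2⟩
    | star f _ hf =>
      rw [star_star]
      exact ⟨hf.2, hf.1⟩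
  refine ⟨hs, _, dense_adjoin_gen, fun X _ Y hY => ?_⟩
  obtain ⟨y, hyd, hyb, hyα, hy⟩ := (hgood Y hY).1
  have hd : Differentiable ℂ fun z => σ (X * y z) :=
    σ.differentiable.comp ((differentiable_const X).mul hyd)
  refine ⟨fun z => σ (X * y z), hd.continuous.continuousOn, hd.differentiableOn, ?_, fun t => ?_⟩
  · obtain ⟨C, hC⟩ := hyb |β|
    refine ⟨‖σ‖ * (‖X‖ * C), fun z hz => (norm_map_mul_le _ _ _).trans ?_⟩
    gcongr
    refine hC z ?_
    have := abs_sub_left_of_mem_uIcc hz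
    simpa using this
  · change σ (X * y t) = _ ∧ σ (X * y (t + β * Complex.I)) = _
    rw [← hy, hyα]
    exact ⟨rfl, rfl⟩

end TransitionMatrix

namespace TransitionMatrix

open Shift
open scoped CStarAlgebra ComplexOrder

/-! ### KMS states restrict to eigenmeasures -/

section Restriction

variable {I : Type u} [Fintype I] [Nonempty I] [TopologicalSpace I] [DiscreteTopology I]
  {A : TransitionMatrix I} {σ : A.CKAlgebra →L[ℂ] ℂ} {H : C(A.Shift, ℝ)} {β : ℝ}

theorem IsModular.mem_eigenmeasures (hσ : IsModular H β σ) {μ : ProbabilityMeasure A.Shift}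
    (hμ : RestrictsTo σ μ) : μ ∈ eigenmeasures (-(β • H)) := by
  intro f
  rw [← hμ, ← hμ, diag_perronFrobenius, map_sum]
  have h : ∀ j, σ (star (A.gen j) * A.diag (cphase H (β * Complex.I) * f) * A.gen j) =
      σ (A.gen j * star (A.gen j) * A.diag f) := fun j => by
    rw [mul_assoc (A.gen j), hσ.gen_mul, mul_comm (cphase H _) f, map_mul A.diag]
    simp only [mul_assoc]
  simp_rw [h]
  rw [← map_sum, ← Finset.sum_mul, isCKFamily_gen.sum_eq_one, one_mul]

end Restriction

/-! ### The change of variables formula for eigenmeasures -/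

namespace Shift

variable {I : Type u} [Fintype I] [Nonempty I] [TopologicalSpace I] [DiscreteTopology I]
  {A : TransitionMatrix I} {H : C(A.Shift, ℝ)} {β : ℝ}

/-- An eigenmeasure is conformal: the inverse branch `y ↦ j y` of the shift has the Jacobian
`e^{-βH(j y)}`. The eigenvalue equation gives this for continuous functions, hence as an identity
of measures, hence for all bounded Borel functions. -/
theorem integral_cylinder_comp_shift {μ : ProbabilityMeasure A.Shift}
    (hμ : μ ∈ eigenmeasures (-(β • H))) (j : I) {φ : A.Shift → ℂ} (hφ : Measurable φ) :
    ∫ x in {x : A.Shift | x.letter 0 = j}, φ x.shift ∂(μ : Measure A.Shift) =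
      ∫ y, (admInd A j * branch j (cphase H (β * Complex.I))) y * φ y ∂(μ : Measure A.Shift) := by
  classical
  have := μ.2
  let w : A.Shift → ℝ := fun y => ((admInd A j * branch j (cphase H (β * Complex.I))) y).re
  have hw : ∀ y, (admInd A j * branch j (cphase H (β * Complex.I))) y = w y ∧ 0 ≤ w y := by
    intro y
    simp only [w, ContinuousMap.mul_apply, branch_apply, cphase_mul_I_apply]
    by_cases h : A.mat j (y.letter 0) = 1
    · rw [admInd_of_adm h, one_mul, Complex.ofReal_re]
      exact ⟨rfl, (Real.exp_pos _).le⟩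
    · rw [admInd_of_not_adm h, zero_mul]
      simp
  have hwc : Continuous w := Complex.continuous_re.comp (ContinuousMap.continuous _)
  have hwm : Measurable fun y => ENNReal.ofReal (w y) := hwc.measurable.ennreal_ofReal
  have hcyl : MeasurableSet {x : A.Shift | x.letter 0 = j} :=
    ((isClopen_discrete {j}).preimage (continuous_letter 0)).isOpen.measurableSet
  let ν₁ : Measure A.Shift :=
    ((μ : Measure A.Shift).restrict {x : A.Shift | x.letter 0 = j}).map shift
  let ν₂ : Measure A.Shift := (μ : Measure A.Shift).withDensity fun y => ENNReal.ofReal (w y)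
  have hν₁ : ∀ ψ : A.Shift → ℂ, Measurable ψ → ∫ y, ψ y ∂ν₁ =
      ∫ x in {x : A.Shift | x.letter 0 = j}, ψ x.shift ∂(μ : Measure A.Shift) := fun ψ hψ =>
    integral_map continuous_shift.measurable.aemeasurable hψ.aestronglyMeasurable
  have hν₂ : ∀ ψ : A.Shift → ℂ, ∫ y, ψ y ∂ν₂ =
      ∫ y, (admInd A j * branch j (cphase H (β * Complex.I))) y * ψ y ∂(μ : Measure A.Shift) := by
    intro ψ
    refine (integral_withDensity_eq_integral_toReal_smul hwm
      (Eventually.of_forall fun y => ENNReal.ofReal_lt_top) ψ).trans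
      (integral_congr_ae (Eventually.of_forall fun y => ?_))
    beta_reduce
    rw [(hw y).1, ENNReal.toReal_ofReal (hw y).2, Complex.real_smul]
  have hfin₂ : IsFiniteMeasure ν₂ := by
    refine isFiniteMeasure_withDensity_ofReal ?_
    exact ((integrable_continuousMap (μ : Measure A.Shift)
      (admInd A j * branch j (cphase H (β * Complex.I)))).re).2
  have hν : ν₁ = ν₂ := measure_ext fun f => by
    rw [hν₁ f f.continuous.measurable, hν₂]
    have h := hμ (cylInd [j] * compShift f)
    rw [← integral_indicator hcyl]
    have e1 : ∀ x : A.Shift, {x : A.Shift | x.letter 0 = j}.indicator (fun x => f x.shift) x =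
        (cylInd [j] * compShift f : C(A.Shift, ℂ)) x := fun x => by
      rw [ContinuousMap.mul_apply, cylInd_singleton_apply, indicator_apply]
      change (if x.letter 0 = j then _ else _) = _
      split_ifs <;> simp
    have e2 : perronFrobenius (-(β • H)) (cylInd [j] * compShift f) =
        admInd A j * branch j (cphase H (β * Complex.I)) * f := by
      rw [perronFrobenius_eq_sum]
      ext x
      rw [ContinuousMap.sum_apply, Finset.sum_eq_single j]
      · by_cases hx : A.mat j (x.letter 0) = 1
        · simp only [ContinuousMap.mul_apply, branch_apply, cylInd_singleton_apply,
            letter_zero_prepend hx, if_true, compShift_apply, shift_prepend hx]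
          ring
        · simp [admInd_of_not_adm hx]
      · intro k _ hk
        by_cases hx : A.mat k (x.letter 0) = 1
        · simp [cylInd_singleton_apply, letter_zero_prepend hx, hk]
        · simp [admInd_of_not_adm hx]
      · simp
    simp_rw [e1]
    rw [← h, e2]
    rfl
  rw [← hν₁ φ hφ, ← hν₂, hν]

end Shift

end TransitionMatrix

/-! ### Partial permutation operators -/

namespace PartialEquiv

open scoped InnerProductSpace

variable {α : Type u}

theorem summable_norm_sq_comp (e : PartialEquiv α α) (ξ : lp (fun _ : α => ℂ) 2) :
    Summable (fun x : e.source => ‖ξ (e x)‖ ^ (2 : ℝ≥0∞).toReal) ∧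
      ∑' x : e.source, ‖ξ (e x)‖ ^ (2 : ℝ≥0∞).toReal ≤ ‖ξ‖ ^ (2 : ℝ≥0∞).toReal := by
  have hs : Summable fun x => ‖ξ x‖ ^ (2 : ℝ≥0∞).toReal := (lp.memℓp ξ).summable (by simp)
  have hinj : Function.Injective fun x : e.source => e x := fun x y h =>
    Subtype.ext (e.injOn x.2 y.2 h)
  refine ⟨hs.comp_injective hinj, ?_⟩
  rw [lp.norm_rpow_eq_tsum (by simp)]
  exact tsum_comp_le_tsum_of_inj hs (fun x => by positivity) hinj

open Classical in
/-- The operator on `ℓ²(α)` that composes a sequence with the partial bijection `e`, extended by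
zero outside the source of `e`. -/
noncomputable def compOp (e : PartialEquiv α α) :
    lp (fun _ : α => ℂ) 2 →L[ℂ] lp (fun _ : α => ℂ) 2 :=
  have hi : ∀ ξ : lp (fun _ : α => ℂ) 2,
      (fun x => ‖if x ∈ e.source then ξ (e x) else 0‖ ^ (2 : ℝ≥0∞).toReal) =
        e.source.indicator fun x => ‖ξ (e x)‖ ^ (2 : ℝ≥0∞).toReal := fun ξ => by
    funext x
    rw [indicator_apply]
    split_ifs <;> simp
  LinearMap.mkContinuous
    { toFun := fun ξ => ⟨fun x => if x ∈ e.source then ξ (e x) else 0, memℓp_gen (by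
        rw [hi]
        exact summable_subtype_iff_indicator.1 (summable_norm_sq_comp e ξ).1)⟩
      map_add' := fun ξ η => by
        ext x
        change (if x ∈ e.source then (ξ + η) (e x) else 0) =
          (if x ∈ e.source then ξ (e x) else 0) + (if x ∈ e.source then η (e x) else 0)
        split_ifs <;> simp
      map_smul' := fun c ξ => by
        ext x
        change (if x ∈ e.source then (c • ξ) (e x) else 0) =
          c • (if x ∈ e.source then ξ (e x) else 0)
        split_ifs <;> simp }
    1 fun ξ => by
      rw [one_mul]
      refine lp.norm_le_of_tsum_le (by simp) (norm_nonneg _) ?_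
      change ∑' x, ‖if x ∈ e.source then ξ (e x) else 0‖ ^ (2 : ℝ≥0∞).toReal ≤ _
      rw [hi, ← tsum_subtype]
      exact (summable_norm_sq_comp e ξ).2

open Classical in
theorem compOp_apply (e : PartialEquiv α α) (ξ : lp (fun _ : α => ℂ) 2) (x : α) :
    compOp e ξ x = if x ∈ e.source then ξ (e x) else 0 := rfl

theorem star_compOp (e : PartialEquiv α α) : star (compOp e) = compOp e.symm := by
  classical
  rw [ContinuousLinearMap.star_eq_adjoint, eq_comm, ContinuousLinearMap.eq_adjoint_iff]
  intro ξ η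
  rw [lp.inner_eq_tsum, lp.inner_eq_tsum]
  have h1 : (fun x => ⟪compOp e.symm ξ x, η x⟫_ℂ) =
      e.target.indicator fun x => ⟪ξ (e.symm x), η x⟫_ℂ := by
    funext x
    rw [compOp_apply, indicator_apply]
    change ⟪if x ∈ e.target then _ else _, _⟫_ℂ = _
    split_ifs <;> simp
  have h2 : (fun x => ⟪ξ x, compOp e η x⟫_ℂ) =
      e.source.indicator fun x => ⟪ξ x, η (e x)⟫_ℂ := by
    funext x
    rw [compOp_apply, indicator_apply]
    split_ifs <;> simp
  rw [h1, h2, ← tsum_subtype, ← tsum_subtype, ← e.toEquiv.tsum_eq]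
  refine tsum_congr fun x => ?_
  change ⟪ξ (e.symm (e x)), η (e x)⟫_ℂ = _
  rw [e.left_inv x.2]

open Classical in
theorem compOp_mul_star_apply (e : PartialEquiv α α) (ξ : lp (fun _ : α => ℂ) 2) (x : α) :
    (compOp e * star (compOp e)) ξ x = if x ∈ e.source then ξ x else 0 := by
  rw [star_compOp, mul_apply_eq_comp, compOp_apply]
  split_ifs with h
  · rw [compOp_apply, symm_source, if_pos (e.map_source h), e.left_inv h]
  · rfl

theorem compOp_mul_star_mul (e : PartialEquiv α α) :
    compOp e * star (compOp e) * compOp e = compOp e := by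
  classical
  refine ContinuousLinearMap.ext fun ξ => lp.ext (funext fun x => ?_)
  rw [mul_apply_eq_comp, compOp_mul_star_apply, compOp_apply]
  split_ifs <;> rfl

end PartialEquiv

namespace TransitionMatrix

open Shift
open scoped CStarAlgebra ComplexOrder

variable {I : Type u} {A : TransitionMatrix I}

/-! ### The representation on `ℓ²(Σ_A)` -/

/-- The partial bijection of `Σ_A` given by the shift on the cylinder set of the letter `j`. -/
noncomputable def shiftPartialEquiv (A : TransitionMatrix I) (j : I) :
    PartialEquiv A.Shift A.Shift where
  toFun := shift
  invFun := prepend j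
  source := {x | x.letter 0 = j}
  target := {x | A.mat j (x.letter 0) = 1}
  map_source' x hx := by
    have : A.mat (x.letter 0) (x.shift.letter 0) = 1 := x.2 0
    rwa [show x.letter 0 = j from hx] at this
  map_target' x hx := letter_zero_prepend hx
  left_inv' x hx := by
    rw [← show x.letter 0 = j from hx, prepend_letter_zero_shift]
  right_inv' x hx := shift_prepend hx

open Classical in
theorem compOp_shiftPartialEquiv_apply (j : I) (ξ : lp (fun _ : A.Shift => ℂ) 2) (x : A.Shift) :
    (shiftPartialEquiv A j).compOp ξ x = if x.letter 0 = j then ξ x.shift else 0 := rfl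

open Classical in
theorem star_compOp_shiftPartialEquiv_apply (j : I) (ξ : lp (fun _ : A.Shift => ℂ) 2)
    (x : A.Shift) : star (shiftPartialEquiv A j).compOp ξ x =
      if A.mat j (x.letter 0) = 1 then ξ (prepend j x) else 0 := by
  rw [PartialEquiv.star_compOp, PartialEquiv.compOp_apply]
  exact if_congr Iff.rfl rfl rfl

variable [Fintype I]

theorem isCKFamily_compOp :
    A.IsCKFamily fun j => (shiftPartialEquiv A j).compOp where
  partial_isometry j := PartialEquiv.compOp_mul_star_mul _
  sum_eq_one := by
    classical
    refine ContinuousLinearMap.ext fun ξ => lp.ext (funext fun x => ?_)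
    rw [sum_apply, lp.coeFn_sum, Finset.sum_apply]
    simp_rw [PartialEquiv.compOp_mul_star_apply]
    change ∑ j, (if x.letter 0 = j then ξ x else 0) = ξ x
    simp
  star_mul_self i := by
    classical
    refine ContinuousLinearMap.ext fun ξ => lp.ext (funext fun x => ?_)
    let ev : (lp (fun _ : A.Shift => ℂ) 2 →L[ℂ] lp (fun _ : A.Shift => ℂ) 2) →+ ℂ :=
      { toFun := fun T => T ξ x
        map_zero' := rfl
        map_add' := fun _ _ => rfl }
    change _ = ev _
    rw [map_sum]
    simp_rw [map_zsmul]
    change _ = ∑ j, A.mat i j • ((shiftPartialEquiv A j).compOp *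
      star (shiftPartialEquiv A j).compOp) ξ x
    simp_rw [PartialEquiv.compOp_mul_star_apply]
    change _ = ∑ j, A.mat i j • (if x.letter 0 = j then ξ x else 0)
    rw [mul_apply_eq_comp, star_compOp_shiftPartialEquiv_apply,
      compOp_shiftPartialEquiv_apply]
    simp only [smul_ite, smul_zero, Finset.sum_ite_eq, Finset.mem_univ, if_true]
    rcases A.zero_or_one i (x.letter 0) with h | h
    · rw [h, zero_smul, if_neg (by decide)]
    · rw [if_pos h, h, one_smul, letter_zero_prepend h, if_pos rfl, shift_prepend h]

/-- The representation of `O_A` on `ℓ²(Σ_A)` in which `S_j` takes the basis vector of the word `x`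
to the basis vector of the word `j x`, or to zero if `j x` is not admissible. -/
noncomputable def shiftRep (A : TransitionMatrix I) :
    A.CKAlgebra →⋆ₐ[ℂ] (lp (fun _ : A.Shift => ℂ) 2 →L[ℂ] lp (fun _ : A.Shift => ℂ) 2) :=
  (exists_lift (isCKFamily_compOp (A := A))).choose

theorem shiftRep_gen (j : I) : shiftRep A (A.gen j) = (shiftPartialEquiv A j).compOp :=
  (exists_lift (isCKFamily_compOp (A := A))).choose_spec j

open Classical in
/-- The matrix coefficients of `shiftRep` in the standard basis of `ℓ²(Σ_A)`. -/
noncomputable def coeff (x y : A.Shift) : A.CKAlgebra →ₗ[ℂ] ℂ where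
  toFun X := shiftRep A X (lp.single 2 y 1) x
  map_add' X Y := by rw [map_add]; rfl
  map_smul' c X := by rw [map_smul]; rfl

open Classical in
theorem coeff_apply (x y : A.Shift) (X : A.CKAlgebra) :
    coeff x y X = shiftRep A X (lp.single 2 y 1) x := rfl

theorem norm_coeff_le (x y : A.Shift) (X : A.CKAlgebra) : ‖coeff x y X‖ ≤ ‖X‖ := by
  classical
  calc ‖coeff x y X‖ ≤ ‖shiftRep A X (lp.single 2 y 1)‖ :=
        lp.norm_apply_le_norm two_ne_zero _ x
    _ ≤ ‖shiftRep A X‖ * ‖lp.single (E := fun _ : A.Shift => ℂ) 2 y 1‖ :=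
        ContinuousLinearMap.le_opNorm _ _
    _ ≤ ‖X‖ := by
      rw [lp.norm_single (by simp), norm_one, mul_one]
      exact NonUnitalStarAlgHom.norm_apply_le _ _

theorem continuous_coeff (x y : A.Shift) : Continuous (coeff x y) :=
  ((coeff x y).mkContinuous 1 fun X => by rw [one_mul]; exact norm_coeff_le x y X).continuous

open Classical in
theorem coeff_one (x y : A.Shift) : coeff x y 1 = if x = y then 1 else 0 := by
  rw [coeff_apply, map_one, one_apply_eq_self, lp.single_apply, Pi.single_apply]

theorem coeff_star_mul_self (x : A.Shift) (X : A.CKAlgebra) : 0 ≤ coeff x x (star X * X) := by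
  classical
  have h : coeff x x (star X * X) =
      inner ℂ (shiftRep A X (lp.single 2 x 1)) (shiftRep A X (lp.single 2 x 1)) := by
    rw [← ContinuousLinearMap.adjoint_inner_right, lp.inner_single_left, coeff_apply, map_mul,
      map_star, ContinuousLinearMap.star_eq_adjoint, mul_apply_eq_comp]
    simp
  rw [h, inner_self_eq_norm_sq_to_K, ← RCLike.ofReal_pow]
  exact Complex.zero_le_real.2 (sq_nonneg _)

open Classical in
theorem coeff_gen_mul (x y : A.Shift) (j : I) (X : A.CKAlgebra) :
    coeff x y (A.gen j * X) = if x.letter 0 = j then coeff x.shift y X else 0 := by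
  rw [coeff_apply, map_mul, shiftRep_gen, mul_apply_eq_comp,
    compOp_shiftPartialEquiv_apply]
  rfl

open Classical in
theorem coeff_star_gen_mul (x y : A.Shift) (j : I) (X : A.CKAlgebra) :
    coeff x y (star (A.gen j) * X) =
      if A.mat j (x.letter 0) = 1 then coeff (prepend j x) y X else 0 := by
  rw [coeff_apply, map_mul, map_star, shiftRep_gen, mul_apply_eq_comp,
    star_compOp_shiftPartialEquiv_apply]
  rfl

open Classical in
theorem coeff_mul_gen (x y : A.Shift) (j : I) (X : A.CKAlgebra) :
    coeff x y (X * A.gen j) =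
      if A.mat j (y.letter 0) = 1 then coeff x (prepend j y) X else 0 := by
  have h : shiftRep A (A.gen j) (lp.single 2 y 1) =
      if A.mat j (y.letter 0) = 1 then lp.single 2 (prepend j y) 1 else 0 := by
    refine lp.ext (funext fun z => ?_)
    rw [shiftRep_gen, compOp_shiftPartialEquiv_apply, lp.single_apply, Pi.single_apply]
    split_ifs with h1 h2 h3 h3
    · rw [lp.single_apply, Pi.single_apply, if_pos]
      rw [← h1, ← h2, prepend_letter_zero_shift]
    · refine absurd ?_ h3
      rw [← h1, ← h2]
      exact z.2 0
    · rw [lp.single_apply, Pi.single_apply, if_neg]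
      rintro rfl
      exact h2 (shift_prepend h3)
    · rfl
    · rw [lp.single_apply, Pi.single_apply, if_neg]
      rintro rfl
      exact h1 (letter_zero_prepend (by assumption))
    · rfl
  rw [coeff_apply, map_mul, mul_apply_eq_comp, h]
  split_ifs
  · rfl
  · rw [map_zero]
    rfl

variable [Nonempty I] [TopologicalSpace I] [DiscreteTopology I]

theorem shiftRep_diag_apply (f : C(A.Shift, ℂ)) (ξ : lp (fun _ : A.Shift => ℂ) 2) (x : A.Shift) :
    shiftRep A (A.diag f) ξ x = f x * ξ x := by
  classical
  induction f using continuousMap_induction generalizing ξ x with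
  | closed =>
    simp only [ofPred_forall]
    refine isClosed_iInter fun ξ => isClosed_iInter fun x => isClosed_eq ?_ ?_
    · have h1 : Continuous fun f => shiftRep A (A.diag f) :=
        (map_continuous (shiftRep A)).comp continuous_diag
      exact (lp.evalCLM ℂ (fun _ : A.Shift => ℂ) 2 x).continuous.comp
        (h1.clm_apply continuous_const)
    · exact (continuous_eval_const x).mul continuous_const
  | cyl w =>
    rw [diag_cylInd]
    induction w generalizing ξ x with
    | nil => simp [wordProj, wordProd, cylInd_nil]
    | cons i w ih =>
      rw [wordProj_cons, map_mul, map_mul, map_star, shiftRep_gen, mul_apply_eq_comp,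
        mul_apply_eq_comp, compOp_shiftPartialEquiv_apply, ih,
        star_compOp_shiftPartialEquiv_apply, cylInd_cons_apply]
      split_ifs with h1 h2
      · rw [← h1, prepend_letter_zero_shift]
      · refine absurd ?_ h2
        rw [← h1]
        exact x.2 0
      · rw [zero_mul]
  | const c =>
    rw [AlgHomClass.commutes, AlgHomClass.commutes, Algebra.algebraMap_eq_smul_one,
      Algebra.algebraMap_eq_smul_one]
    simp
  | add f g hf hg =>
    rw [map_add, map_add, ContinuousMap.add_apply, add_mul, ← hf, ← hg]
    rfl
  | mul f g hf hg =>
    rw [map_mul, map_mul, mul_apply_eq_comp, hf, hg, ContinuousMap.mul_apply, mul_assoc]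

theorem coeff_diag_mul (x y : A.Shift) (f : C(A.Shift, ℂ)) (X : A.CKAlgebra) :
    coeff x y (A.diag f * X) = f x * coeff x y X := by
  rw [coeff_apply, map_mul, mul_apply_eq_comp, shiftRep_diag_apply]
  rfl

theorem coeff_mul_diag (x y : A.Shift) (f : C(A.Shift, ℂ)) (X : A.CKAlgebra) :
    coeff x y (X * A.diag f) = f y * coeff x y X := by
  classical
  have h : shiftRep A (A.diag f) (lp.single 2 y 1) = f y • lp.single 2 y (1 : ℂ) := by
    refine lp.ext (funext fun z => ?_)
    rw [shiftRep_diag_apply, lp.coeFn_smul, Pi.smul_apply, smul_eq_mul, lp.single_apply,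
      Pi.single_apply]
    split_ifs with hz
    · rw [hz]
    · simp
  rw [coeff_apply, map_mul, mul_apply_eq_comp, h, map_smul]
  rfl

/-- Along continuous maps the matrix coefficients are Borel functions: this holds for the unit and
is preserved by left multiplication with the generators and their adjoints, by linear combinations
and by limits. -/
theorem measurable_coeff (X : A.CKAlgebra) {a b : A.Shift → A.Shift} (ha : Continuous a)
    (hb : Continuous b) : Measurable fun x => coeff (a x) (b x) X := by
  classical
  have hmul : ∀ X ∈ StarAlgebra.adjoin ℂ (range A.gen), ∀ Y : A.CKAlgebra,
      (∀ a b : A.Shift → A.Shift, Continuous a → Continuous b →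
        Measurable fun x => coeff (a x) (b x) Y) →
      (∀ a b : A.Shift → A.Shift, Continuous a → Continuous b →
        Measurable fun x => coeff (a x) (b x) (X * Y)) ∧
      (∀ a b : A.Shift → A.Shift, Continuous a → Continuous b →
        Measurable fun x => coeff (a x) (b x) (star X * Y)) := by
    intro X hX
    induction hX using StarAlgebra.adjoin_induction with
    | mem X hX =>
      obtain ⟨j, rfl⟩ := hX
      refine fun Y hY => ⟨fun a b ha hb => ?_, fun a b ha hb => ?_⟩
      · simp_rw [coeff_gen_mul]
        refine Measurable.ite ?_ (hY _ _ (continuous_shift.comp ha) hb) measurable_const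
        exact ((isClopen_discrete {j}).preimage
          ((continuous_letter 0).comp ha)).isOpen.measurableSet
      · simp_rw [coeff_star_gen_mul]
        refine Measurable.ite ?_ (hY _ _ ((continuous_prepend j).comp ha) hb) measurable_const
        exact ((isClopen_admissible j).preimage ha).isOpen.measurableSet
    | algebraMap c =>
      rw [← algebraMap_star_comm]
      refine fun Y hY => ⟨fun a b ha hb => ?_, fun a b ha hb => ?_⟩ <;>
      · simp_rw [Algebra.algebraMap_eq_smul_one, smul_mul_assoc, one_mul, map_smul, smul_eq_mul]
        exact (hY a b ha hb).const_mul _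
    | add f g _ _ hf hg =>
      rw [star_add]
      refine fun Y hY => ⟨fun a b ha hb => ?_, fun a b ha hb => ?_⟩ <;> simp_rw [add_mul, map_add]
      · exact ((hf Y hY).1 a b ha hb).add ((hg Y hY).1 a b ha hb)
      · exact ((hf Y hY).2 a b ha hb).add ((hg Y hY).2 a b ha hb)
    | mul f g _ _ hf hg =>
      rw [star_mul]
      refine fun Y hY => ⟨?_, ?_⟩
      · rw [mul_assoc]
        exact (hf _ (hg Y hY).1).1
      · rw [mul_assoc]
        exact (hg _ (hf Y hY).2).2
    | star f _ hf =>
      rw [star_star]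
      exact fun Y hY => (hf Y hY).symm
  have hone : ∀ a b : A.Shift → A.Shift, Continuous a → Continuous b →
      Measurable fun x => coeff (a x) (b x) (1 : A.CKAlgebra) := fun a b ha hb => by
    simp_rw [coeff_one]
    exact Measurable.ite (isClosed_eq ha hb).measurableSet measurable_const measurable_const
  obtain ⟨Xs, hXs, hXl⟩ := mem_closure_iff_seq_limit.1 (dense_adjoin_gen X)
  refine measurable_of_tendsto_metrizable (f := fun n x => coeff (a x) (b x) (Xs n))
    (fun n => ?_) (tendsto_pi_nhds.2 fun x => ((continuous_coeff _ _).tendsto _).comp hXl)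
  have := (hmul (Xs n) (hXs n) 1 hone).1 a b ha hb
  rwa [mul_one] at this

/-! ### The KMS state of an eigenmeasure -/

theorem integrable_coeff (μ : Measure A.Shift) [IsFiniteMeasure μ] (X : A.CKAlgebra) :
    Integrable (fun x => coeff x x X) μ :=
  Integrable.of_bound (measurable_coeff X continuous_id continuous_id).aestronglyMeasurable ‖X‖
    (Eventually.of_forall fun x => norm_coeff_le x x X)

/-- The integral of the vector states of the basis vectors of `ℓ²(Σ_A)`. -/
noncomputable def vectorStateIntegral (μ : ProbabilityMeasure A.Shift) : A.CKAlgebra →L[ℂ] ℂ :=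
  LinearMap.mkContinuous
    { toFun := fun X => ∫ x, coeff x x X ∂(μ : Measure A.Shift)
      map_add' := fun X Y => by
        have := μ.2
        simp_rw [map_add]
        exact integral_add (integrable_coeff _ X) (integrable_coeff _ Y)
      map_smul' := fun c X => by
        simp_rw [map_smul]
        exact integral_smul c _ }
    1 fun X => by
      have := μ.2
      rw [one_mul]
      refine (norm_integral_le_of_norm_le_const
        (Eventually.of_forall fun x => norm_coeff_le x x X)).trans ?_
      simp

theorem vectorStateIntegral_apply (μ : ProbabilityMeasure A.Shift) (X : A.CKAlgebra) :
    vectorStateIntegral μ X = ∫ x, coeff x x X ∂(μ : Measure A.Shift) := rfl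

theorem isState_vectorStateIntegral (μ : ProbabilityMeasure A.Shift) :
    IsState (vectorStateIntegral μ) := by
  have := μ.2
  have h1 : vectorStateIntegral μ 1 = 1 := by
    rw [vectorStateIntegral_apply]
    simp [coeff_one]
  refine ⟨le_antisymm (LinearMap.mkContinuous_norm_le _ zero_le_one _) ?_, fun X => ?_⟩
  · have hn : Nontrivial A.CKAlgebra := by
      refine ⟨0, 1, fun h => ?_⟩
      rw [← h, map_zero] at h1
      exact zero_ne_one h1
    have := (vectorStateIntegral μ).le_opNorm 1
    rwa [h1, norm_one, CStarRing.norm_one, mul_one] at this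
  · rw [vectorStateIntegral_apply]
    have h : ∀ x : A.Shift, coeff x x (star X * X) = ((coeff x x (star X * X)).re : ℂ) := fun x =>
      Complex.ext rfl (Complex.nonneg_iff.1 (coeff_star_mul_self x X)).2.symm
    rw [integral_congr_ae (Eventually.of_forall h), integral_complex_ofReal]
    exact Complex.zero_le_real.2 (integral_nonneg fun x =>
      (Complex.nonneg_iff.1 (coeff_star_mul_self x X)).1)

theorem restrictsTo_vectorStateIntegral (μ : ProbabilityMeasure A.Shift) :
    RestrictsTo (vectorStateIntegral μ) μ := by
  intro f
  rw [vectorStateIntegral_apply]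
  refine integral_congr_ae (Eventually.of_forall fun x => ?_)
  have := coeff_diag_mul x x f 1
  rw [mul_one, coeff_one, if_pos rfl, mul_one] at this
  exact this

theorem isModular_vectorStateIntegral {H : C(A.Shift, ℝ)} {β : ℝ} {μ : ProbabilityMeasure A.Shift}
    (hμ : μ ∈ eigenmeasures (-(β • H))) : IsModular H β (vectorStateIntegral μ) where
  diag_comm f X := by
    simp_rw [vectorStateIntegral_apply, coeff_diag_mul, coeff_mul_diag]
  gen_mul j X := by
    classical
    have hcyl : MeasurableSet {x : A.Shift | x.letter 0 = j} :=
      ((isClopen_discrete {j}).preimage (continuous_letter 0)).isOpen.measurableSet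
    have h := integral_cylinder_comp_shift hμ j
      (measurable_coeff X continuous_id (continuous_prepend j))
    rw [vectorStateIntegral_apply, vectorStateIntegral_apply]
    refine Eq.trans ?_ (h.trans ?_)
    · rw [← integral_indicator hcyl]
      refine integral_congr_ae (Eventually.of_forall fun x => ?_)
      beta_reduce
      rw [coeff_gen_mul, indicator_apply]
      change (if x.letter 0 = j then _ else _) = (if x.letter 0 = j then _ else _)
      split_ifs with hx
      · rw [← hx, prepend_letter_zero_shift]
        rfl
      · rfl
    · refine integral_congr_ae (Eventually.of_forall fun y => ?_)
      beta_reduce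
      rw [← mul_assoc, coeff_mul_gen, ContinuousMap.mul_apply, branch_apply, coeff_mul_diag]
      split_ifs with hy
      · rw [admInd_of_adm hy, one_mul]
        rfl
      · rw [admInd_of_not_adm hy, zero_mul, zero_mul]

end TransitionMatrix

namespace TransitionMatrix

open Shift
open scoped CStarAlgebra ComplexOrder

variable {I : Type u} [Fintype I] [Nonempty I] [TopologicalSpace I] [DiscreteTopology I]
  {A : TransitionMatrix I} {σ τ : A.CKAlgebra →L[ℂ] ℂ} {H : C(A.Shift, ℝ)} {β : ℝ}

/-! ### Monomials in the generators -/

theorem exists_diag_mul_wordProd (v : List I) (g : C(A.Shift, ℂ)) :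
    ∃ g', A.diag g * wordProd A.gen v = wordProd A.gen v * A.diag g' := by
  induction v generalizing g with
  | nil => exact ⟨g, by simp [wordProd]⟩
  | cons j v ih =>
    obtain ⟨g', hg'⟩ := ih (branch j g)
    refine ⟨g', ?_⟩
    rw [wordProd_cons, ← mul_assoc, diag_mul_gen, mul_assoc, hg', mul_assoc]

theorem exists_star_wordProd_mul_diag (v : List I) (g : C(A.Shift, ℂ)) :
    ∃ g', star (wordProd A.gen v) * A.diag g = A.diag g' * star (wordProd A.gen v) := by
  obtain ⟨g', hg'⟩ := exists_diag_mul_wordProd v (star g)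
  refine ⟨star g', ?_⟩
  have := congrArg star hg'
  rwa [star_mul, star_mul, ← map_star, ← map_star, star_star] at this

theorem star_gen_mul_diag_mul_gen_of_ne {j k : I} (h : k ≠ j) (g : C(A.Shift, ℂ)) :
    star (A.gen k) * A.diag g * A.gen j = 0 := by
  rw [star_gen_mul_diag, mul_assoc, isCKFamily_gen.star_mul_of_ne h, mul_zero]

/-- The linear span of the elements `S_v f S_w^*`. -/
noncomputable def monomialSpan (A : TransitionMatrix I) : Submodule ℂ A.CKAlgebra :=
  Submodule.span ℂ {X | ∃ (v w : List I) (f : C(A.Shift, ℂ)),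
    X = wordProd A.gen v * A.diag f * star (wordProd A.gen w)}

theorem monomial_mem_monomialSpan (v w : List I) (f : C(A.Shift, ℂ)) :
    wordProd A.gen v * A.diag f * star (wordProd A.gen w) ∈ monomialSpan A :=
  Submodule.subset_span ⟨v, w, f, rfl⟩

theorem gen_mul_mem_monomialSpan (j : I) {Y : A.CKAlgebra} (hY : Y ∈ monomialSpan A) :
    A.gen j * Y ∈ monomialSpan A := by
  induction hY using Submodule.span_induction with
  | mem Y hY =>
    obtain ⟨v, w, f, rfl⟩ := hY
    have := monomial_mem_monomialSpan (A := A) (j :: v) w f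
    rwa [wordProd_cons, mul_assoc, mul_assoc, ← mul_assoc (wordProd A.gen v)] at this
  | zero => rw [mul_zero]; exact Submodule.zero_mem _
  | add Y Z _ _ hY hZ => rw [mul_add]; exact Submodule.add_mem _ hY hZ
  | smul c Y _ hY => rw [mul_smul_comm]; exact Submodule.smul_mem _ _ hY

theorem star_gen_mul_mem_monomialSpan (j : I) {Y : A.CKAlgebra} (hY : Y ∈ monomialSpan A) :
    star (A.gen j) * Y ∈ monomialSpan A := by
  induction hY using Submodule.span_induction with
  | mem Y hY =>
    obtain ⟨v, w, f, rfl⟩ := hY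
    cases v with
    | nil =>
      have := monomial_mem_monomialSpan (A := A) [] (w ++ [j]) (branch j f)
      have e : wordProd A.gen [j] = A.gen j := by simp [wordProd]
      rw [wordProd_append, star_mul, e, ← mul_assoc, mul_assoc (wordProd A.gen []),
        ← star_gen_mul_diag, ← mul_assoc] at this
      have h1 : wordProd A.gen [] = 1 := rfl
      rw [h1, one_mul] at this ⊢
      rwa [← mul_assoc]
    | cons k v =>
      rw [wordProd_cons]
      simp only [← mul_assoc]
      by_cases hjk : j = k
      · subst hjk
        obtain ⟨g, hg⟩ := exists_diag_mul_wordProd v (admInd A j)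
        rw [star_gen_mul_gen, hg, mul_assoc (wordProd A.gen v), ← map_mul]
        exact monomial_mem_monomialSpan v w _
      · rw [isCKFamily_gen.star_mul_of_ne hjk]
        simp only [zero_mul]
        exact Submodule.zero_mem _
  | zero => rw [mul_zero]; exact Submodule.zero_mem _
  | add Y Z _ _ hY hZ => rw [mul_add]; exact Submodule.add_mem _ hY hZ
  | smul c Y _ hY => rw [mul_smul_comm]; exact Submodule.smul_mem _ _ hY

theorem dense_monomialSpan : Dense (monomialSpan A : Set A.CKAlgebra) := by
  have hmul : ∀ X ∈ StarAlgebra.adjoin ℂ (range A.gen), ∀ Y ∈ monomialSpan A,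
      X * Y ∈ monomialSpan A ∧ star X * Y ∈ monomialSpan A := by
    intro X hX
    induction hX using StarAlgebra.adjoin_induction with
    | mem X hX =>
      obtain ⟨j, rfl⟩ := hX
      exact fun Y hY => ⟨gen_mul_mem_monomialSpan j hY, star_gen_mul_mem_monomialSpan j hY⟩
    | algebraMap c =>
      rw [← algebraMap_star_comm]
      refine fun Y hY => ⟨?_, ?_⟩ <;>
      · rw [Algebra.algebraMap_eq_smul_one, smul_mul_assoc, one_mul]
        exact Submodule.smul_mem _ _ hY
    | add f g _ _ hf hg =>
      rw [star_add]
      refine fun Y hY => ⟨?_, ?_⟩ <;> rw [add_mul]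
      · exact Submodule.add_mem _ (hf Y hY).1 (hg Y hY).1
      · exact Submodule.add_mem _ (hf Y hY).2 (hg Y hY).2
    | mul f g _ _ hf hg =>
      rw [star_mul]
      refine fun Y hY => ⟨?_, ?_⟩ <;> rw [mul_assoc]
      · exact (hf _ (hg Y hY).1).1
      · exact (hg _ (hf Y hY).2).2
    | star f _ hf =>
      rw [star_star]
      exact fun Y hY => (hf Y hY).symm
  refine dense_adjoin_gen.mono fun X hX => ?_
  have h1 := monomial_mem_monomialSpan (A := A) [] [] 1
  have e : wordProd A.gen [] = 1 := rfl
  rw [e, map_one, star_one, mul_one, mul_one] at h1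
  have := (hmul X hX 1 h1).1
  rwa [mul_one] at this

/-! ### KMS states that vanish off the core -/

/-- The KMS identity strips equal numbers of letters from the two words of a monomial, so a state
is determined by its values on `C(Σ_A)` and on the elements `f S_u`. -/
theorem IsModular.ext (hσ : IsModular H β σ) (hτ : IsModular H β τ) (hσs : IsState σ)
    (hτs : IsState τ) (hd : ∀ f, σ (A.diag f) = τ (A.diag f))
    (hσ0 : ∀ u : List I, u ≠ [] → ∀ f, σ (A.diag f * wordProd A.gen u) = 0)
    (hτ0 : ∀ u : List I, u ≠ [] → ∀ f, τ (A.diag f * wordProd A.gen u) = 0) : σ = τ := by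
  have e : wordProd A.gen [] = 1 := rfl
  have hmon : ∀ (v w : List I) (f : C(A.Shift, ℂ)),
      σ (wordProd A.gen v * A.diag f * star (wordProd A.gen w)) =
        τ (wordProd A.gen v * A.diag f * star (wordProd A.gen w)) := by
    intro v
    induction v with
    | nil =>
      intro w f
      rw [e, one_mul]
      by_cases hw : w = []
      · rw [hw, e, star_one, mul_one, hd]
      · have h0 : ∀ ρ : A.CKAlgebra →L[ℂ] ℂ, IsModular H β ρ → IsState ρ →
            (∀ u : List I, u ≠ [] → ∀ f, ρ (A.diag f * wordProd A.gen u) = 0) →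
            ρ (A.diag f * star (wordProd A.gen w)) = 0 := by
          intro ρ hρ hρs hρ0
          have h := hρ0 w hw (star f)
          rw [hρ.diag_comm, ← star_star (wordProd A.gen w), map_star, ← star_mul,
            map_star_of_nonneg hρs.nonneg, star_eq_zero] at h
          exact h
        rw [h0 σ hσ hσs hσ0, h0 τ hτ hτs hτ0]
    | cons j v ih =>
      intro w f
      cases w with
      | nil =>
        rw [e, star_one, mul_one, ← hσ.diag_comm, ← hτ.diag_comm, hσ0 _ (by simp),
          hτ0 _ (by simp)]
      | cons k w =>
        rw [wordProd_cons, wordProd_cons, star_mul]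
        simp only [mul_assoc]
        rw [hσ.gen_mul, hτ.gen_mul]
        by_cases hkj : k = j
        · subst hkj
          obtain ⟨g, hg⟩ := exists_star_wordProd_mul_diag w
            (admInd A k * branch k (cphase H (β * Complex.I)))
          have h : wordProd A.gen v * (A.diag f * (star (wordProd A.gen w) * star (A.gen k))) *
              (A.diag (cphase H (β * Complex.I)) * A.gen k) =
              wordProd A.gen v * A.diag (f * g) * star (wordProd A.gen w) := by
            rw [map_mul]
            simp only [mul_assoc]
            rw [← hg, ← star_gen_mul_diag_mul_gen, mul_assoc]
          rw [h]
          exact ih w _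
        · have h : wordProd A.gen v * (A.diag f * (star (wordProd A.gen w) * star (A.gen k))) *
              (A.diag (cphase H (β * Complex.I)) * A.gen j) = 0 := by
            simp only [mul_assoc]
            rw [← mul_assoc (star (A.gen k)), star_gen_mul_diag_mul_gen_of_ne hkj]
            simp only [mul_zero]
          rw [h, map_zero, map_zero]
  have heq : EqOn σ τ (monomialSpan A) := by
    intro X hX
    induction hX using Submodule.span_induction with
    | mem X hX =>
      obtain ⟨v, w, f, rfl⟩ := hX
      exact hmon v w f
    | zero => rw [map_zero, map_zero]
    | add X Y _ _ hX hY => rw [map_add, map_add, hX, hY]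
    | smul c X _ hX => rw [map_smul, map_smul, hX]
  exact DFunLike.ext' (Continuous.ext_on dense_monomialSpan σ.continuous τ.continuous heq)

/-- The KMS identity for words: `σ(S_u X) = σ(X e^{-βg} S_u)`, where `g` is the Birkhoff sum of `H`
along `u`. For `H ≥ 0` only the bounds `0 ≤ g` and `H ≤ g` matter. -/
theorem IsModular.exists_wordProd_mul (hσ : IsModular H β σ) (hH : ∀ x, 0 ≤ H x) (u : List I) :
    ∃ g : C(A.Shift, ℝ), (∀ x, 0 ≤ g x) ∧ (u ≠ [] → ∀ x, H x ≤ g x) ∧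
      ∀ X, σ (wordProd A.gen u * X) =
        σ (X * (A.diag (cphase g (β * Complex.I)) * wordProd A.gen u)) := by
  induction u with
  | nil =>
    refine ⟨0, fun x => le_rfl, fun h => absurd rfl h, fun X => ?_⟩
    have h1 : cphase (0 : C(A.Shift, ℝ)) (β * Complex.I) = 1 := by ext x; simp
    have h2 : wordProd A.gen [] = 1 := rfl
    rw [h1, h2, map_one, one_mul, one_mul, mul_one]
  | cons j u ih =>
    obtain ⟨g, hg0, -, hg⟩ := ih
    refine ⟨H + g.comp ⟨shift, continuous_shift⟩, fun x => add_nonneg (hH x) (hg0 _),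
      fun _ x => le_add_of_nonneg_right (hg0 _), fun X => ?_⟩
    have h : cphase (H + g.comp ⟨shift, continuous_shift⟩) (β * Complex.I) =
        cphase H (β * Complex.I) * compShift (cphase g (β * Complex.I)) := by
      ext x
      simp only [ContinuousMap.mul_apply, compShift_apply, cphase_apply, ← Complex.exp_add,
        ContinuousMap.add_apply, ContinuousMap.comp_apply, ContinuousMap.coe_mk]
      congr 1
      push_cast
      ring
    rw [wordProd_cons, mul_assoc, hσ.gen_mul, mul_assoc, hg, h, map_mul A.diag]
    congr 1
    simp only [mul_assoc]
    rw [← mul_assoc (A.gen j), gen_mul_diag, mul_assoc]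

theorem norm_map_diag_mul_sq_le (hs : IsState σ) {μ : ProbabilityMeasure A.Shift}
    (hμ : RestrictsTo σ μ) (f : C(A.Shift, ℂ)) (X : A.CKAlgebra) :
    ‖σ (A.diag f * X)‖ ^ 2 ≤
      (∫ x, ‖f x‖ ^ 2 ∂(μ : Measure A.Shift)) * (σ (star X * X)).re := by
  have h := norm_map_star_mul_sq_le hs.nonneg (A.diag (star f)) X
  rw [← map_star, star_star, ← map_mul A.diag, hμ] at h
  have e : ∀ x, (f * star f) x = ((‖f x‖ ^ 2 : ℝ) : ℂ) := fun x => by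
    rw [ContinuousMap.mul_apply, ContinuousMap.star_apply, Complex.star_def, Complex.mul_conj,
      Complex.normSq_eq_norm_sq]
  simp_rw [e] at h
  rwa [integral_complex_ofReal, Complex.ofReal_re] at h

/-- If `m_σ` gives no mass to `{H = 0}`, then `σ` vanishes on all `f S_u` with a nonempty word `u`:
the KMS identity gives `σ(f (1 - e^{-βg}) S_u) = 0` for all `f`, and the functions divisible by
`1 - e^{-βg}`, whose zeros lie in `{H = 0}`, are dense in `L²(m_σ)`. -/
theorem IsModular.map_diag_mul_wordProd_eq_zero (hσ : IsModular H β σ) (hs : IsState σ)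
    (hβ : β ≠ 0) (hH : ∀ x, 0 ≤ H x) {μ : ProbabilityMeasure A.Shift} (hμ : RestrictsTo σ μ)
    (h0 : (μ : Measure A.Shift) {x | H x = 0} = 0) {u : List I} (hu : u ≠ [])
    (f : C(A.Shift, ℂ)) : σ (A.diag f * wordProd A.gen u) = 0 := by
  have := μ.2
  obtain ⟨g, hg0, hgH, hg⟩ := hσ.exists_wordProd_mul hH u
  let h : C(A.Shift, ℝ) := ⟨fun x => 1 - Real.exp (-(β * g x)), by fun_prop⟩
  have hne : ∀ x, H x ≠ 0 → h x ≠ 0 := by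
    intro x hx hhx
    have h1 : 1 - Real.exp (-(β * g x)) = 0 := hhx
    have h2 : Real.exp (-(β * g x)) = 1 := by linarith
    rw [Real.exp_eq_one_iff, neg_eq_zero, mul_eq_zero, or_iff_right hβ] at h2
    exact hx (le_antisymm (h2 ▸ hgH hu x) (hH x))
  have hzero : ∀ q : C(A.Shift, ℂ), σ (A.diag (q * toComplex h) * wordProd A.gen u) = 0 := by
    intro q
    have h1 : toComplex h = 1 - cphase g (β * Complex.I) := by
      ext x
      rw [ContinuousMap.sub_apply, cphase_mul_I_apply]
      simp [h]
    have h2 := hg (A.diag q)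
    rw [← hσ.diag_comm, ← mul_assoc, ← map_mul A.diag] at h2
    rw [h1, mul_sub, mul_one, map_sub, sub_mul, map_sub, h2, sub_self]
  have hden : ∀ (n : ℕ) x, 0 < 1 + n * h x ^ 2 := fun n x => by positivity
  -- `k n + q n * h = 1`, and `k n` tends to the indicator function of `{h = 0}`
  let k : ℕ → C(A.Shift, ℝ) := fun n =>
    ⟨fun x => (1 + n * h x ^ 2)⁻¹, by
      have := fun x => (hden n x).ne'
      fun_prop (disch := assumption)⟩
  let q : ℕ → C(A.Shift, ℝ) := fun n => ((n : ℝ) • h) * k n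
  have hk : ∀ n, toComplex (k n) = 1 - toComplex (q n) * toComplex h := by
    intro n
    ext x
    have h1 : k n x = 1 - q n x * h x := by
      change (1 + n * h x ^ 2)⁻¹ = 1 - n * h x * (1 + n * h x ^ 2)⁻¹ * h x
      have := (hden n x).ne'
      field_simp
      ring
    simp only [ContinuousMap.sub_apply, ContinuousMap.mul_apply, toComplex_apply, h1]
    push_cast
    rfl
  have hkσ : ∀ n, σ (A.diag f * wordProd A.gen u) =
      σ (A.diag (f * toComplex (k n)) * wordProd A.gen u) := by
    intro n
    rw [hk, mul_sub, mul_one, map_sub, sub_mul, map_sub, ← mul_assoc, hzero, sub_zero]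
  have hk01 : ∀ n x, 0 ≤ k n x ∧ k n x ≤ 1 := fun n x =>
    ⟨inv_nonneg.2 (hden n x).le, inv_le_one_of_one_le₀ (by
      have : 0 ≤ n * h x ^ 2 := by positivity
      linarith)⟩
  have hlim : Tendsto (fun n => ∫ x, ‖(f * toComplex (k n)) x‖ ^ 2 ∂(μ : Measure A.Shift)) atTop
      (𝓝 0) := by
    have hint : ∫ _, (0 : ℝ) ∂(μ : Measure A.Shift) = 0 := integral_zero _ _
    rw [← hint]
    refine tendsto_integral_of_dominated_convergence (fun _ => ‖f‖ ^ 2) (fun n => ?_)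
      (integrable_const _) (fun n => Eventually.of_forall fun x => ?_) ?_
    · exact ((f * toComplex (k n)).continuous.norm.pow 2).measurable.aestronglyMeasurable
    · rw [Real.norm_of_nonneg (by positivity), ContinuousMap.mul_apply, norm_mul, toComplex_apply,
        Complex.norm_real, Real.norm_of_nonneg (hk01 n x).1]
      refine pow_le_pow_left₀ (mul_nonneg (norm_nonneg _) (hk01 n x).1) ?_ 2
      exact (mul_le_of_le_one_right (norm_nonneg _) (hk01 n x).2).trans (f.norm_coe_le_norm x)
    · have hae : ∀ᵐ x ∂(μ : Measure A.Shift), H x ≠ 0 := by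
        rw [ae_iff]
        simpa using h0
      filter_upwards [hae] with x hx
      have hpos : 0 < h x ^ 2 := by have := hne x hx; positivity
      have hkx : Tendsto (fun n => k n x) atTop (𝓝 0) :=
        tendsto_inv_atTop_zero.comp (tendsto_atTop_add_const_left _ _
          (tendsto_natCast_atTop_atTop.atTop_mul_const hpos))
      have := ((hkx.norm.const_mul ‖f x‖).pow 2)
      simpa [mul_pow] using this
  have hle : ‖σ (A.diag f * wordProd A.gen u)‖ ^ 2 ≤
      0 * (σ (star (wordProd A.gen u) * wordProd A.gen u)).re :=
    ge_of_tendsto (hlim.mul_const _) (Eventually.of_forall fun n => by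
      rw [hkσ n]
      exact norm_map_diag_mul_sq_le hs hμ _ _)
  rw [zero_mul] at hle
  exact norm_eq_zero.1 (pow_eq_zero_iff two_ne_zero |>.1 (le_antisymm hle (sq_nonneg _)))

end TransitionMatrix

theorem fact2p11 {I : Type u} [Fintype I] [Nontrivial I] [TopologicalSpace I] [DiscreteTopology I]
    (A : TransitionMatrix I) (hA : A.mat.IsIrreducible)
    (H : C(A.Shift, ℝ)) (β : ℝ) (hβ : β ≠ 0) :
    ∃ Θ : A.kmsStates H β → TransitionMatrix.Shift.eigenmeasures (-(β • H)),
      (∀ (σ : A.kmsStates H β) (μ : ProbabilityMeasure A.Shift),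
        TransitionMatrix.RestrictsTo σ.1 μ ↔ μ = (Θ σ).1) ∧
      Function.Surjective Θ ∧
      ((∀ x, 0 ≤ H x) →
        BijOn Θ {σ | ((Θ σ).1 : Measure A.Shift) {x | H x = 0} = 0}
          {μ | (μ.1 : Measure A.Shift) {x | H x = 0} = 0}) := by
  have hmod : ∀ σ : A.kmsStates H β, TransitionMatrix.IsModular H β σ.1 := fun σ =>
    TransitionMatrix.IsKMSState.isModular σ.2 hβ
  have hst : ∀ σ : A.kmsStates H β, TransitionMatrix.IsState σ.1 := fun σ => σ.2.isState
  choose m hm using fun σ : A.kmsStates H β => (hst σ).exists_restrictsTo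
  have hΘ : ∀ (σ : A.kmsStates H β) (μ : ProbabilityMeasure A.Shift),
      TransitionMatrix.RestrictsTo σ.1 μ ↔ μ = m σ := fun σ μ =>
    ⟨fun h => h.unique (hm σ), fun h => h ▸ hm σ⟩
  have hsurj : Function.Surjective fun σ : A.kmsStates H β =>
      (⟨m σ, (hmod σ).mem_eigenmeasures (hm σ)⟩ :
        TransitionMatrix.Shift.eigenmeasures (-(β • H))) := fun μ =>
    ⟨⟨TransitionMatrix.vectorStateIntegral μ.1,
      (TransitionMatrix.isModular_vectorStateIntegral μ.2).isKMSState
        (TransitionMatrix.isState_vectorStateIntegral μ.1)⟩,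
      Subtype.ext ((hΘ _ μ.1).1 (TransitionMatrix.restrictsTo_vectorStateIntegral μ.1)).symm⟩
  refine ⟨_, hΘ, hsurj, fun hH => ⟨fun σ hσ => hσ, fun σ hσ τ hτ hστ => ?_, fun μ hμ => ?_⟩⟩
  · have hm' : m σ = m τ := congrArg Subtype.val hστ
    refine Subtype.ext ((hmod σ).ext (hmod τ) (hst σ) (hst τ) (fun f => ?_)
      (fun u hu f => (hmod σ).map_diag_mul_wordProd_eq_zero (hst σ) hβ hH (hm σ) hσ hu f)
      (fun u hu f => (hmod τ).map_diag_mul_wordProd_eq_zero (hst τ) hβ hH (hm τ) hτ hu f))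
    rw [hm σ, hm τ, hm']
  · obtain ⟨σ, rfl⟩ := hsurj μ
    exact ⟨σ, hμ, rfl⟩
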